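/- A plane tree is a finite rooted tree in which the children of every vertex are linearly ordered; its size is its number of vertices. The protection number of a vertex $v$ of a plane tree is the minimal distance from $v$ to a leaf of the maximal subtree rooted at $v$ (so it is $0$ if and only if $v$ is a leaf). For $n\ge 1$ let $Y_n$ be the protection number of a uniformly random vertex of a uniformly random plane tree with $n$ vertices. Then $Y_n$ has a discrete limit law: for every $k\ge 0$, \[ \lim_{n\to\infty}\mathbb P(Y_n=k)=p_k:=\frac{9\cdot 4^k}{(4\cdot 4^k+2)(4^k+2)}, \] where $p_k\ge 0$ and $\sum_{k\ge 0}p_k=1$. More precisely, as $n\to\infty$, uniformly in $k\ge 0$, \[ \mathbb P(Y_n=k)=\frac{9\cdot 4^k}{(4\cdot 4^k+2)(4^k+2)}+\frac{3\cdot 4^k(4^k-1)\bigl((6k-22)4^{3k}+(21k+30)4^{2k}+(21k+96)4^k+(6k+58)\bigr)}{2(4^k+2)^3(2\cdot 4^k+1)^3}\,\frac1n+O\Bigl(\frac{k^2}{3^k n^2}\Bigr). \] Define, by convergent series, \[ d_0=\sum_{k\ge1}\frac{3}{4^k+2},\qquad d_1=\sum_{k\ge1}\frac{(3k-10)4^{2k}+(6k+26)4^k-16}{2(4^k+2)^3},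 \] \[ d_2=\sum_{k\ge1}\frac{3(2k-1)}{4^k+2}-d_0^2,\qquad d_3=\sum_{k\ge1}\frac{(2k-1)\bigl((3k-10)4^{2k}+(6k+26)4^k-16\bigr)}{2(4^k+2)^3}-2d_0d_1. \] Numerically, each with an error of less than one unit in the last given digit, \begin{align*} d_0&\approx 0.727649276913726097531184400482145348863515722775042276537008,\\ d_1&\approx -0.0311837125986222774945246489936100437425899128713521725307175,\\ d_2&\approx 0.81689937948362892278879205623322983539562628691031631640757,\\ d_3&\approx -0.008069306849577412439260970341290668150739539610413792698447. \end{align*} Then, as $n\to\infty$, \[ \mathbb E(Y_n)=d_0+\frac{d_1}{n}+O(n^{-3/2}),\qquad \mathbb V(Y_n)=d_2+\frac{d_3}{n}+O(n^{-3/2}). \] -/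

import Mathlib

open MeasureTheory ProbabilityTheory Filter Topology Asymptotics

/-- Finite rooted plane (ordered) trees: a root together with the finite sequence of the
branches attached to it. -/
inductive PlaneTree : Type
  | node (branches : List PlaneTree) : PlaneTree

namespace PlaneTree

/-- The maximal subtree whose root has address `p`, if there is such a vertex. The root has
address `[]`, and `i :: p` is the vertex with address `p` in the `i`-th branch. -/
def subtreeAt : PlaneTree → List ℕ → Option PlaneTree
  | t, [] => some t
  | node ts, i :: p => ts[i]?.bind fun s => subtreeAt s p

/-- The set of (addresses of) vertices of a plane tree. -/
def vertexSet (t : PlaneTree) : Set (List ℕ) := {p | (t.subtreeAt p).isSome}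

/-- `p` is the address of a leaf, that is, of a vertex without children. -/
def IsLeaf (t : PlaneTree) (p : List ℕ) : Prop := t.subtreeAt p = some (node [])

/-- The protection number of the vertex `p` of `t`: the minimal distance from `p` to a leaf of
the maximal subtree with root `p`. The vertices of that subtree are those with an address
`p ++ q`, and their distance from `p` is the length of `q`. -/
noncomputable def protectionNumber (t : PlaneTree) (p : List ℕ) : ℕ :=
  sInf {d : ℕ | ∃ q : List ℕ, t.IsLeaf (p ++ q) ∧ q.length = d}

/-- The number of vertices. -/
noncomputable def size (t : PlaneTree) : ℕ := t.vertexSet.ncard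

theorem nil_mem_vertexSet (t : PlaneTree) : [] ∈ t.vertexSet := by
  simp [vertexSet, subtreeAt]

theorem cons_mem_vertexSet (ts : List PlaneTree) (i : ℕ) (p : List ℕ) :
    i :: p ∈ (node ts).vertexSet ↔ ∃ s, ts[i]? = some s ∧ p ∈ s.vertexSet := by
  cases h : ts[i]? <;> simp [vertexSet, subtreeAt, h]

theorem finite_vertexSet : ∀ t : PlaneTree, t.vertexSet.Finite
  | node ts => by
    have ih : ∀ i : Fin ts.length, (ts[i]).vertexSet.Finite := fun i => finite_vertexSet ts[i]
    refine ((Set.finite_iUnion fun i : Fin ts.length =>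
      (ih i).image (fun p => i.val :: p)).insert []).subset ?_
    rintro (_ | ⟨i, p⟩) hp
    · exact Set.mem_insert _ _
    · obtain ⟨s, hs, hp⟩ := (cons_mem_vertexSet ts i p).1 hp
      obtain ⟨hi, rfl⟩ := List.getElem?_eq_some_iff.1 hs
      exact Set.mem_insert_of_mem _ (Set.mem_iUnion.2 ⟨⟨i, hi⟩, p, hp, rfl⟩)
termination_by t => sizeOf t
decreasing_by
  have := List.sizeOf_lt_of_mem (List.getElem_mem i.2)
  simp only [node.sizeOf_spec, Fin.getElem_fin]
  omega

theorem length_lt_size (ts : List PlaneTree) : ts.length < (node ts).size := by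
  have h1 : insert [] ((fun i : ℕ => [i]) '' Set.Iio ts.length) ⊆ (node ts).vertexSet := by
    rintro _ (rfl | ⟨i, hi, rfl⟩)
    · exact nil_mem_vertexSet _
    · exact (cons_mem_vertexSet ts i []).2
        ⟨ts[i]'hi, List.getElem?_eq_getElem hi, nil_mem_vertexSet _⟩
  have h2 := Set.ncard_le_ncard h1 (finite_vertexSet _)
  rw [Set.ncard_insert_of_notMem (by simp) ((Set.finite_Iio _).image _),
    Set.ncard_image_of_injective _ (fun a b h => by simpa using h)] at h2
  have h3 : (Set.Iio ts.length).ncard = ts.length := by simp [Set.ncard_eq_toFinset_card']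
  rw [h3] at h2
  exact h2

theorem size_lt_of_mem {ts : List PlaneTree} {s : PlaneTree} (hs : s ∈ ts) :
    s.size < (node ts).size := by
  obtain ⟨i, hi, rfl⟩ := List.getElem_of_mem hs
  have h1 : insert [] ((fun p => i :: p) '' (ts[i]).vertexSet) ⊆ (node ts).vertexSet := by
    rintro _ (rfl | ⟨p, hp, rfl⟩)
    · exact nil_mem_vertexSet _
    · exact (cons_mem_vertexSet ts i p).2 ⟨_, List.getElem?_eq_getElem hi, hp⟩
  have h2 := Set.ncard_le_ncard h1 (finite_vertexSet _)
  rw [Set.ncard_insert_of_notMem (by simp) ((finite_vertexSet _).image _),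
    Set.ncard_image_of_injective _ (fun a b h => by simpa using h)] at h2
  exact h2

theorem finite_size_le (n : ℕ) : {t : PlaneTree | t.size ≤ n}.Finite := by
  induction n with
  | zero =>
    refine Set.finite_empty.subset ?_
    rintro ⟨ts⟩ h
    have := length_lt_size ts
    simp only [Set.mem_ofPred_eq] at h
    omega
  | succ n ih =>
    have := ih.to_subtype
    refine ((List.finite_length_le {t : PlaneTree | t.size ≤ n} n).image
      fun l => node (l.map Subtype.val)).subset ?_
    rintro ⟨ts⟩ h
    simp only [Set.mem_ofPred_eq] at h
    have hts : ∀ s ∈ ts, s ∈ {t : PlaneTree | t.size ≤ n} := fun s hs => by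
      have := size_lt_of_mem hs
      simp only [Set.mem_ofPred_eq]
      omega
    have := length_lt_size ts
    refine ⟨ts.attach.map fun s => ⟨s.1, hts s.1 s.2⟩, ?_, ?_⟩
    · simp only [Set.mem_ofPred_eq, List.length_map, List.length_attach]
      omega
    · simp [Function.comp_def]

theorem exists_size_eq (n : ℕ+) : ∃ t : PlaneTree, t.size = n := by
  induction n using PNat.recOn with
  | one =>
    refine ⟨node [], ?_⟩
    have : (node []).vertexSet = {[]} := by
      ext p
      cases p with
      | nil => simp [nil_mem_vertexSet]
      | cons i p => simp [cons_mem_vertexSet]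
    simp [size, this]
  | succ n ih =>
    obtain ⟨t, ht⟩ := ih
    refine ⟨node [t], ?_⟩
    have : (node [t]).vertexSet = insert [] ((fun p => 0 :: p) '' t.vertexSet) := by
      ext p
      cases p with
      | nil => simp [nil_mem_vertexSet]
      | cons i p => cases i <;> simp [cons_mem_vertexSet]
    rw [size, this, Set.ncard_insert_of_notMem (by simp) ((finite_vertexSet _).image _),
      Set.ncard_image_of_injective _ (fun a b h => by simpa using h)]
    simpa [size] using ht

/-- Plane trees with `n` vertices. -/
abbrev OfSize (n : ℕ+) : Type := {t : PlaneTree // t.size = n}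

instance (n : ℕ+) : Finite (OfSize n) :=
  ((finite_size_le n).subset fun _ h => le_of_eq h).to_subtype

noncomputable instance (n : ℕ+) : Fintype (OfSize n) := Fintype.ofFinite _

instance (n : ℕ+) : Nonempty (OfSize n) := nonempty_subtype.2 (exists_size_eq n)

noncomputable instance (t : PlaneTree) : Fintype t.vertexSet := (finite_vertexSet t).fintype

instance (t : PlaneTree) : Nonempty t.vertexSet := ⟨⟨[], nil_mem_vertexSet t⟩⟩

/-- A plane tree with `n` vertices together with one of its vertices. -/
structure Pointed (n : ℕ+) : Type where
  tree : OfSize n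
  vertex : tree.1.vertexSet

instance (n : ℕ+) : MeasurableSpace (Pointed n) := ⊤

/-- Choose a plane tree with `n` vertices uniformly at random, and then one of its vertices
uniformly at random. -/
noncomputable def randomPointed (n : ℕ+) : PMF (Pointed n) :=
  (PMF.uniformOfFintype (OfSize n)).bind fun t =>
    (PMF.uniformOfFintype t.1.vertexSet).map fun v => ⟨t, v⟩

/-- The probability measure of the random choice of a vertex in a random tree. -/
noncomputable def P (n : ℕ+) : Measure (Pointed n) := (randomPointed n).toMeasure

/-- The random variable `Y n`: the protection number of the chosen vertex. -/
noncomputable def Y (n : ℕ+) (ω : Pointed n) : ℕ := protectionNumber ω.tree.1 ω.vertex.1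

/-- The limit of the probability that `Y n = k`. -/
noncomputable def limitProb (k : ℕ) : ℝ := 9 * 4 ^ k / ((4 * 4 ^ k + 2) * (4 ^ k + 2))

/-- The coefficient of `1 / n` in the expansion of the probability that `Y n = k`. -/
noncomputable def correctionProb (k : ℕ) : ℝ :=
  3 * 4 ^ k * (4 ^ k - 1) *
      ((6 * k - 22) * 4 ^ (3 * k) + (21 * k + 30) * 4 ^ (2 * k) + (21 * k + 96) * 4 ^ k
        + (6 * k + 58)) /
    (2 * (4 ^ k + 2) ^ 3 * (2 * 4 ^ k + 1) ^ 3)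

/-- The summand of the constant `d₀`. -/
noncomputable def a (k : ℕ) : ℝ := 3 / (4 ^ k + 2)

/-- The summand of the constant `d₁`. -/
noncomputable def b (k : ℕ) : ℝ :=
  ((3 * k - 10) * 4 ^ (2 * k) + (6 * k + 26) * 4 ^ k - 16) / (2 * (4 ^ k + 2) ^ 3)

noncomputable def d₀ : ℝ := ∑' k : ℕ+, a k

noncomputable def d₁ : ℝ := ∑' k : ℕ+, b k

noncomputable def d₂ : ℝ := (∑' k : ℕ+, (2 * (k : ℝ) - 1) * a k) - d₀ ^ 2

noncomputable def d₃ : ℝ := (∑' k : ℕ+, (2 * (k : ℝ) - 1) * b k) - 2 * d₀ * d₁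

end PlaneTree

namespace PlaneTree

/-! ### Recursive description of trees, protection numbers and vertex counts -/

/-! Every plane tree except the single vertex splits uniquely into its first branch `s` and the
remaining tree `t` (`cons s t`), and sizes add. With T = `treeSeries`, R_k = `rootSeries k`, V_k =
`vertexSeries k` this gives T = X + T², R_{k+1}(1 - R_k) = X R_k and V_k(1 - 2T) = R_k(1 - T). The
recursion for R_k is a Möbius map, solved in closed form by `rootSeries_mul`, and 1/(1 - 2T) = (1 -
4X)^(-1/2) is the series S of central binomial coefficients. Rationalizing with the conjugation T ↦
1 - T yields V_{k+2} = X(A_k S - B_k), where A_k = `singularPart k` and B_k = `regularPart k` are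
rational (`vertexSeries_add_two`). All trees of size n have equally many vertices, so P(Y_n ≥ k) is
the n-th coefficient of V_k divided by the (n-1)-st central binomial coefficient (`tailProb_eq`).

Singularity analysis is replaced by an elementary estimate. The j-th coefficients of A_k and B_k are
O(3^(j-k)), so both series converge beyond 1/4. The normalized ratio of the central binomial
coefficients of indices m - j and m is 1 + j/(2(m+1)) + O(j⁴/m²). Convolution with A_k therefore
gives A_k(1/4) plus 1/(2n) times the value of X A_k' at 1/4, with n = m + 1, while B_k is
negligible. These values are `a (k + 2)` and `2 * b (k + 2)`, whence P(Y_n ≥ k) = a_k + b_k/n +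
O(3^(-k) n^(-2)) uniformly in k (`abs_tailProb_sub_le`); for k = 0, 1 and n ≥ 2 there is no error at
all.

Differences in k give the point probabilities. Sums over k ≥ 1 with weights 1 and 2k - 1 give the
first two moments, even with error O(n^(-2)). The decimals come from integer arithmetic on truncated
sums and a geometric bound for the tails. -/

theorem isLeaf_nil_iff (ts : List PlaneTree) : (node ts).IsLeaf [] ↔ ts = [] := by
  simp [IsLeaf, subtreeAt]

theorem isLeaf_cons_iff (ts : List PlaneTree) (i : ℕ) (p : List ℕ) :
    (node ts).IsLeaf (i :: p) ↔ ∃ s, ts[i]? = some s ∧ s.IsLeaf p := by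
  cases h : ts[i]? <;> simp [IsLeaf, subtreeAt, h]

theorem exists_isLeaf : ∀ t : PlaneTree, ∃ p, t.IsLeaf p
  | node [] => ⟨[], (isLeaf_nil_iff _).2 rfl⟩
  | node (s :: ts) => by
    obtain ⟨p, hp⟩ := exists_isLeaf s
    exact ⟨0 :: p, (isLeaf_cons_iff _ _ _).2 ⟨s, rfl, hp⟩⟩

theorem le_protectionNumber_nil_iff (t : PlaneTree) (k : ℕ) :
    k ≤ t.protectionNumber [] ↔ ∀ q, t.IsLeaf q → k ≤ q.length := by
  -- The infimum of the empty set in ℕ is 0, so the characterization needs the existence of a leaf.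
  have hne : {d : ℕ | ∃ q : List ℕ, t.IsLeaf ([] ++ q) ∧ q.length = d}.Nonempty := by
    obtain ⟨q, hq⟩ := exists_isLeaf t
    exact ⟨_, q, hq, rfl⟩
  rw [protectionNumber, le_csInf_iff (OrderBot.bddBelow _) hne]
  simp

theorem protectionNumber_cons {ts : List PlaneTree} {i : ℕ} {s : PlaneTree}
    (h : ts[i]? = some s) (p : List ℕ) :
    (node ts).protectionNumber (i :: p) = s.protectionNumber p := by
  simp [protectionNumber, isLeaf_cons_iff, h]

theorem succ_le_protectionNumber_node_iff (ts : List PlaneTree) (k : ℕ) :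
    k + 1 ≤ (node ts).protectionNumber [] ↔
      ts ≠ [] ∧ ∀ s ∈ ts, k ≤ s.protectionNumber [] := by
  simp only [le_protectionNumber_nil_iff]
  constructor
  · intro h
    refine ⟨fun h0 => ?_, fun s hs q hq => ?_⟩
    · simpa using h [] ((isLeaf_nil_iff _).2 h0)
    · obtain ⟨i, hi, rfl⟩ := List.getElem_of_mem hs
      simpa using h (i :: q) ((isLeaf_cons_iff _ _ _).2 ⟨_, List.getElem?_eq_getElem hi, hq⟩)
  · rintro ⟨h0, h⟩ (_ | ⟨i, q⟩) hq
    · exact absurd ((isLeaf_nil_iff _).1 hq) h0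
    · obtain ⟨s, hs, hq⟩ := (isLeaf_cons_iff _ _ _).1 hq
      simpa using h s (List.mem_of_getElem? hs) q hq

/-- Attach `s` as the first branch at the root. -/
def cons (s : PlaneTree) : PlaneTree → PlaneTree
  | node ts => node (s :: ts)

theorem cons_ne_leaf (s t : PlaneTree) : cons s t ≠ node [] := by
  cases t
  simp [cons]

theorem cons_inj {s t s' t' : PlaneTree} : cons s t = cons s' t' ↔ s = s' ∧ t = t' := by
  cases t
  cases t'
  simp [cons]

theorem eq_leaf_or_exists_cons (t : PlaneTree) : t = node [] ∨ ∃ s t', t = cons s t' := by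
  obtain ⟨_ | ⟨s, ts⟩⟩ := t
  · exact .inl rfl
  · exact .inr ⟨s, node ts, rfl⟩

/-- The vertices of protection number at least `k`. -/
def protectedSet (k : ℕ) (t : PlaneTree) : Set (List ℕ) :=
  {p | p ∈ t.vertexSet ∧ k ≤ t.protectionNumber p}

/-- The number of vertices of protection number at least `k`. -/
noncomputable def countProtected (k : ℕ) (t : PlaneTree) : ℕ := (protectedSet k t).ncard

/-- The number of vertices of protection number at least `k`, not counting the root. -/
noncomputable def countProtectedBelow (k : ℕ) (t : PlaneTree) : ℕ :=
  (protectedSet k t \ {[]}).ncard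

theorem finite_protectedSet (k : ℕ) (t : PlaneTree) : (protectedSet k t).Finite :=
  (finite_vertexSet t).subset fun _ h => h.1

theorem countProtected_eq (k : ℕ) (t : PlaneTree) :
    countProtected k t =
      countProtectedBelow k t + if k ≤ t.protectionNumber [] then 1 else 0 := by
  unfold countProtected countProtectedBelow
  split_ifs with h
  · exact (Set.ncard_sdiff_singleton_add_one
      (show [] ∈ protectedSet k t from ⟨nil_mem_vertexSet t, h⟩) (finite_protectedSet k t)).symm
  · rw [Set.sdiff_singleton_eq_self fun h' => h h'.2, add_zero]

theorem countProtected_zero (t : PlaneTree) : countProtected 0 t = t.size := by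
  simp [countProtected, protectedSet, size]

theorem countProtectedBelow_leaf (k : ℕ) : countProtectedBelow k (node []) = 0 := by
  have : protectedSet k (node []) \ {[]} = ∅ := by
    ext p
    cases p <;> simp [protectedSet, cons_mem_vertexSet]
  simp [countProtectedBelow, this]

/-- Shift the first entry of an address by one branch. -/
def shiftAddress : List ℕ → List ℕ
  | [] => []
  | i :: p => (i + 1) :: p

theorem shiftAddress_injective : Function.Injective shiftAddress := by
  rintro (_ | ⟨i, p⟩) (_ | ⟨j, q⟩) h <;> simp_all [shiftAddress]

theorem cons_mem_protectedSet (k : ℕ) (ts : List PlaneTree) (i : ℕ) (p : List ℕ) :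
    i :: p ∈ protectedSet k (node ts) ↔ ∃ s, ts[i]? = some s ∧ p ∈ protectedSet k s := by
  simp only [protectedSet, Set.mem_ofPred_eq, cons_mem_vertexSet]
  constructor
  · rintro ⟨⟨s, hs, hp⟩, hk⟩
    exact ⟨s, hs, hp, protectionNumber_cons hs p ▸ hk⟩
  · rintro ⟨s, hs, hp, hk⟩
    exact ⟨⟨s, hs, hp⟩, (protectionNumber_cons hs p).symm ▸ hk⟩

/-- The roots of `t` and of `cons s t` are merged, and only the root's own protection number is
affected by attaching `s`. Hence the count without the root is the one that is additive: the
vertices of `s` get addresses `0 :: p`, the others are shifted. -/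
theorem countProtectedBelow_cons (k : ℕ) (s t : PlaneTree) :
    countProtectedBelow k (cons s t) = countProtected k s + countProtectedBelow k t := by
  obtain ⟨ts⟩ := t
  have h : protectedSet k (cons s (node ts)) \ {[]} =
      (fun p => 0 :: p) '' protectedSet k s ∪
        shiftAddress '' (protectedSet k (node ts) \ {[]}) := by
    ext p
    rcases p with _ | ⟨_ | i, p⟩
    · simp only [Set.mem_sdiff, Set.mem_singleton_iff, not_true_eq_false, and_false, Set.mem_union,
        Set.mem_image, false_iff, not_or, not_exists, not_and]
      refine ⟨fun _ _ => by simp, ?_⟩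
      rintro (_ | ⟨i, p⟩) hp <;> simp_all [shiftAddress]
    · simp only [cons, Set.mem_sdiff, cons_mem_protectedSet, Set.mem_union, Set.mem_image]
      constructor
      · rintro ⟨⟨s, hs, hp⟩, -⟩
        simp only [List.getElem?_cons_zero, Option.some.injEq] at hs
        subst hs
        exact .inl ⟨p, hp, rfl⟩
      · rintro (⟨q, hq, h⟩ | ⟨q, hq, h⟩)
        · simp only [List.cons.injEq, true_and] at h
          subst h
          exact ⟨⟨s, rfl, hq⟩, by simp⟩
        · cases q <;> simp [shiftAddress] at h
    · simp only [cons, Set.mem_sdiff, cons_mem_protectedSet, Set.mem_union, Set.mem_image]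
      constructor
      · rintro ⟨⟨s', hs, hp⟩, -⟩
        exact .inr ⟨i :: p, ⟨(cons_mem_protectedSet _ _ _ _).2 ⟨s', by simpa using hs, hp⟩,
          by simp⟩, rfl⟩
      · rintro (⟨q, hq, h⟩ | ⟨q, ⟨hq, -⟩, h⟩)
        · simp at h
        · rcases q with _ | ⟨j, q⟩
          · simp [shiftAddress] at h
          · simp only [shiftAddress, List.cons.injEq, Nat.add_right_cancel_iff] at h
            obtain ⟨rfl, rfl⟩ := h
            obtain ⟨s', hs, hp⟩ := (cons_mem_protectedSet _ _ _ _).1 hq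
            exact ⟨⟨s', by simpa using hs, hp⟩, by simp⟩
  rw [countProtectedBelow, h, Set.ncard_union_eq ?_ ((finite_protectedSet k s).image _)
    ((finite_protectedSet k _).sdiff.image _), Set.ncard_image_of_injective _ (by intro; simp),
    Set.ncard_image_of_injective _ shiftAddress_injective]
  · rfl
  · rw [Set.disjoint_left]
    rintro _ ⟨p, -, rfl⟩ ⟨q, -, h⟩
    cases q <;> simp [shiftAddress] at h

theorem size_eq_countProtectedBelow (t : PlaneTree) : t.size = countProtectedBelow 0 t + 1 := by
  rw [← countProtected_zero, countProtected_eq]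
  simp

theorem size_leaf : (node []).size = 1 := by
  rw [size_eq_countProtectedBelow, countProtectedBelow_leaf]

theorem size_cons (s t : PlaneTree) : (cons s t).size = s.size + t.size := by
  rw [size_eq_countProtectedBelow, size_eq_countProtectedBelow t, countProtectedBelow_cons,
    countProtected_zero, add_assoc]

/-- All branches at the root have protection number at least `k`. -/
def BranchesProtected (k : ℕ) : PlaneTree → Prop
  | node ts => ∀ s ∈ ts, k ≤ s.protectionNumber []

theorem branchesProtected_leaf (k : ℕ) : BranchesProtected k (node []) := by
  simp [BranchesProtected]

theorem branchesProtected_cons (k : ℕ) (s t : PlaneTree) :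
    BranchesProtected k (cons s t) ↔ k ≤ s.protectionNumber [] ∧ BranchesProtected k t := by
  cases t
  simp [BranchesProtected, cons]

theorem succ_le_protectionNumber_cons_iff (k : ℕ) (s t : PlaneTree) :
    k + 1 ≤ (cons s t).protectionNumber [] ↔
      k ≤ s.protectionNumber [] ∧ BranchesProtected k t := by
  rw [← branchesProtected_cons]
  cases t
  simp only [cons, succ_le_protectionNumber_node_iff, BranchesProtected]
  simp

theorem protectionNumber_leaf : (node []).protectionNumber [] = 0 := by
  have := (succ_le_protectionNumber_node_iff [] 0).1.mt (by simp)
  omega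

/-! ### Generating functions -/

/-- The plane trees of size `n`. -/
noncomputable def trees (n : ℕ) : Finset PlaneTree :=
  Set.Finite.toFinset (s := {t | t.size = n}) ((finite_size_le n).subset fun _ h => le_of_eq h)

theorem mem_trees {n : ℕ} {t : PlaneTree} : t ∈ trees n ↔ t.size = n := by
  simp [trees]

/-- The unique decomposition into a leaf or a `cons`, sorted by size; every generating function
identity below comes from it. -/
theorem sum_trees (w : PlaneTree → ℝ) (n : ℕ) :
    ∑ t ∈ trees n, w t = (if n = 1 then w (node []) else 0) +
      ∑ ij ∈ Finset.HasAntidiagonal.antidiagonal n,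
        ∑ s ∈ trees ij.1, ∑ t ∈ trees ij.2, w (cons s t) := by
  classical
  have h1 : trees n = (if n = 1 then {node []} else ∅) ∪
      (Finset.HasAntidiagonal.antidiagonal n).biUnion fun ij =>
        (trees ij.1 ×ˢ trees ij.2).image fun st => cons st.1 st.2 := by
    ext t
    simp only [mem_trees, Finset.mem_union, Finset.mem_biUnion, Finset.mem_image,
      Finset.mem_product, Finset.HasAntidiagonal.mem_antidiagonal, Prod.exists]
    rcases eq_leaf_or_exists_cons t with rfl | ⟨s, t, rfl⟩
    · have := fun s t => cons_ne_leaf s t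
      split_ifs with h <;> simp [size_leaf, h, this]
      omega
    · rw [size_cons]
      have : cons s t ∉ (if n = 1 then {node []} else ∅ : Finset PlaneTree) := by
        split_ifs <;> simp [cons_ne_leaf]
      simp only [this, false_or]
      constructor
      · intro h
        exact ⟨_, _, h, s, t, ⟨rfl, rfl⟩, rfl⟩
      · rintro ⟨a, b, h, s', t', ⟨rfl, rfl⟩, h'⟩
        obtain ⟨rfl, rfl⟩ := cons_inj.1 h'
        exact h
  rw [h1, Finset.sum_union, Finset.sum_biUnion]
  · congr 1
    · split_ifs <;> simp
    · refine Finset.sum_congr rfl fun ij _ => ?_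
      rw [Finset.sum_image, Finset.sum_product]
      rintro ⟨s, t⟩ - ⟨s', t'⟩ - h
      simpa using cons_inj.1 h
  · rintro ⟨i, j⟩ - ⟨i', j'⟩ - hne
    simp only [Function.onFun, Finset.disjoint_left, Finset.mem_image, Finset.mem_product,
      mem_trees]
    rintro _ ⟨⟨s, t⟩, ⟨rfl, rfl⟩, rfl⟩ ⟨⟨s', t'⟩, ⟨rfl, rfl⟩, h⟩
    obtain ⟨h1, h2⟩ := cons_inj.1 h
    simp only at h1 h2
    subst h1 h2
    exact hne rfl
  · rw [Finset.disjoint_left]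
    intro t ht ht'
    simp only [Finset.mem_biUnion, Finset.mem_image] at ht'
    obtain ⟨_, _, st, _, rfl⟩ := ht'
    split_ifs at ht <;> simp [cons_ne_leaf] at ht

open PowerSeries

/-- The generating function of the plane trees, weighted by `w`. -/
noncomputable def genFun (w : PlaneTree → ℝ) : ℝ⟦X⟧ := PowerSeries.mk fun n => ∑ t ∈ trees n, w t

theorem genFun_eq_of_cons {w u v : PlaneTree → ℝ} (h : ∀ s t, w (cons s t) = u s * v t) :
    genFun w = C (w (node [])) * X + genFun u * genFun v := by
  ext n
  simp only [genFun, coeff_mk, map_add, coeff_C_mul, coeff_X]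
  rw [sum_trees, coeff_mul]
  congr 1
  · simp
  · refine Finset.sum_congr rfl fun ij _ => ?_
    simp [h, Finset.sum_mul_sum]

theorem genFun_add (u v : PlaneTree → ℝ) : genFun (fun t => u t + v t) = genFun u + genFun v := by
  ext n
  simp [genFun, Finset.sum_add_distrib]

/-- The product rule for additive parameters such as a number of vertices, whose weight on `cons s
t` is a sum of two products. -/
theorem genFun_eq_of_cons_add {w u v u' v' : PlaneTree → ℝ}
    (h : ∀ s t, w (cons s t) = u s * v t + u' s * v' t) (h0 : w (node []) = 0) :
    genFun w = genFun u * genFun v + genFun u' * genFun v' := by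
  ext n
  simp only [genFun, coeff_mk, map_add, coeff_mul]
  rw [sum_trees, ← Finset.sum_add_distrib]
  simp [h0, h, Finset.sum_mul_sum, Finset.sum_add_distrib]

/-- The generating function of plane trees. -/
noncomputable def treeSeries : ℝ⟦X⟧ := genFun fun _ => 1

open Classical in
/-- The generating function of plane trees whose root has protection number at least `k`. -/
noncomputable def rootSeries (k : ℕ) : ℝ⟦X⟧ :=
  genFun fun t => if k ≤ t.protectionNumber [] then 1 else 0

open Classical in
/-- The generating function of plane trees all of whose branches have protection number at least
`k`. -/
noncomputable def branchSeries (k : ℕ) : ℝ⟦X⟧ :=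
  genFun fun t => if BranchesProtected k t then 1 else 0

/-- The generating function of the number of vertices with protection number at least `k`. -/
noncomputable def vertexSeries (k : ℕ) : ℝ⟦X⟧ := genFun fun t => countProtected k t

/-! ### Functional equations -/

theorem treeSeries_eq : treeSeries = X + treeSeries * treeSeries := by
  have := genFun_eq_of_cons (w := fun _ => 1) (u := fun _ => 1) (v := fun _ => 1) (by simp)
  simpa [treeSeries] using this

theorem rootSeries_zero : rootSeries 0 = treeSeries := by
  simp [rootSeries, treeSeries]

theorem branchSeries_eq (k : ℕ) : branchSeries k = X + rootSeries k * branchSeries k := by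
  classical
  have := genFun_eq_of_cons (w := fun t => if BranchesProtected k t then 1 else 0)
    (u := fun t => if k ≤ t.protectionNumber [] then 1 else 0)
    (v := fun t => if BranchesProtected k t then 1 else 0) (fun s t => by
      rw [ite_zero_mul_ite_zero, mul_one]
      simp only [branchesProtected_cons])
  simpa [branchSeries, rootSeries, branchesProtected_leaf] using this

theorem rootSeries_succ (k : ℕ) : rootSeries (k + 1) = rootSeries k * branchSeries k := by
  classical
  have := genFun_eq_of_cons (w := fun t => if k + 1 ≤ t.protectionNumber [] then 1 else 0)
    (u := fun t => if k ≤ t.protectionNumber [] then 1 else 0)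
    (v := fun t => if BranchesProtected k t then 1 else 0) (fun s t => by
      rw [ite_zero_mul_ite_zero, mul_one]
      simp only [succ_le_protectionNumber_cons_iff])
  simpa [branchSeries, rootSeries, protectionNumber_leaf] using this

/-- With B the series for the count without the root, V = B + R, and the additivity over `cons`
reads B = V T + T B. Eliminating B leaves this identity. -/
theorem vertexSeries_mul (k : ℕ) :
    vertexSeries k * (1 - 2 * treeSeries) = rootSeries k * (1 - treeSeries) := by
  classical
  set B := genFun fun t => (countProtectedBelow k t : ℝ) with hB
  have h1 : vertexSeries k = B + rootSeries k := by
    rw [hB, rootSeries, ← genFun_add, vertexSeries]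
    simp [countProtected_eq]
  have h2 : B = vertexSeries k * treeSeries + treeSeries * B :=
    genFun_eq_of_cons_add (fun s t => by simp [countProtectedBelow_cons])
      (by simp [countProtectedBelow_leaf])
  linear_combination (1 - treeSeries) * h1 + h2

/-- Eliminates the branch series, which equals X/(1 - R_k): a root with protection number at least k
+ 1 carries a nonempty sequence of branches counted by R_k. -/
theorem rootSeries_succ_mul (k : ℕ) :
    rootSeries (k + 1) * (1 - rootSeries k) = X * rootSeries k := by
  linear_combination (1 - rootSeries k) * rootSeries_succ k + rootSeries k * branchSeries_eq k

/-- The generating function of the central binomial coefficients. -/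
noncomputable def centralSeries : ℝ⟦X⟧ := PowerSeries.mk fun m => (m.centralBinom : ℝ)

/-- The differential equation of (1 - 4X)^(-1/2); on coefficients it is the two-term recurrence of
the central binomial coefficients. -/
theorem centralSeries_derivative : (1 - 4 * X) * d⁄dX ℝ centralSeries = 2 * centralSeries := by
  have h4 : (4 : ℝ⟦X⟧) = C 4 := (map_ofNat C 4).symm
  have h2 : (2 : ℝ⟦X⟧) = C 2 := (map_ofNat C 2).symm
  ext n
  rw [sub_mul, one_mul, mul_assoc, h4, h2, map_sub, coeff_C_mul, coeff_C_mul]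
  rcases n with _ | n
  · simp [coeff_derivative, centralSeries, Nat.centralBinom]
  · rw [coeff_succ_X_mul, coeff_derivative, coeff_derivative]
    simp only [centralSeries, coeff_mk]
    have h := Nat.succ_mul_centralBinom_succ (n + 1)
    have h' : ((n : ℝ) + 1 + 1) * (n + 1 + 1).centralBinom =
        2 * (2 * (n + 1) + 1) * (n + 1).centralBinom := by exact_mod_cast h
    push_cast
    linear_combination h'

/-- By the differential equation the left side has derivative zero, and its constant coefficient is
1. -/
theorem centralSeries_sq : centralSeries * centralSeries * (1 - 4 * X) = 1 := by
  refine derivative.ext ?_ ?_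
  · have h := centralSeries_derivative
    have h4 : d⁄dX ℝ (4 : ℝ⟦X⟧) = 0 := by
      rw [show (4 : ℝ⟦X⟧) = C 4 from (map_ofNat C 4).symm, derivative_C]
    simp only [Derivation.leibniz, map_sub, derivative_one, derivative_X, h4, smul_eq_mul]
    linear_combination 2 * centralSeries * h
  · simp [centralSeries]

theorem constantCoeff_treeSeries : constantCoeff treeSeries = 0 := by
  rw [← coeff_zero_eq_constantCoeff_apply, treeSeries, genFun, coeff_mk]
  refine Finset.sum_eq_zero fun t ht => ?_
  have := mem_trees.1 ht
  rw [size_eq_countProtectedBelow] at this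
  omega

theorem treeSeries_mul_centralSeries : (1 - 2 * treeSeries) * centralSeries = 1 := by
  -- Both (1 - 2T)² and S⁻² equal 1 - 4X, so (1 - 2T)S is 1 or -1; the constant coefficients decide
  -- the sign.
  have h1 : ((1 - 2 * treeSeries) * centralSeries - 1) *
      ((1 - 2 * treeSeries) * centralSeries + 1) = 0 := by
    linear_combination centralSeries_sq - 4 * centralSeries ^ 2 * treeSeries_eq
  rcases mul_eq_zero.1 h1 with h | h
  · exact sub_eq_zero.1 h
  · have := congrArg constantCoeff h
    simp [constantCoeff_treeSeries, centralSeries] at this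

theorem vertexSeries_eq (k : ℕ) :
    vertexSeries k = rootSeries k * (1 - treeSeries) * centralSeries := by
  linear_combination centralSeries * vertexSeries_mul k -
    vertexSeries k * treeSeries_mul_centralSeries

theorem vertexSeries_zero : vertexSeries 0 = X * centralSeries := by
  rw [vertexSeries_eq, rootSeries_zero]
  linear_combination centralSeries * treeSeries_eq

theorem two_mul_vertexSeries_one : 2 * vertexSeries 1 = X * (centralSeries - 1) := by
  rw [vertexSeries_eq]
  have h := rootSeries_succ_mul 0
  rw [rootSeries_zero, zero_add] at h
  linear_combination 2 * centralSeries * h - X * treeSeries_mul_centralSeries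

/-- R ↦ XR/(1 - R) is a Möbius map: the reciprocals satisfy the affine recursion 1/R_{k+1} = (1/R_k
- 1)/X, which can be solved explicitly. -/
theorem rootSeries_mul (k : ℕ) :
    rootSeries k * (1 - X - treeSeries + X ^ k * treeSeries) = (1 - X) * X ^ k * treeSeries := by
  induction k with
  | zero =>
    rw [rootSeries_zero]
    ring
  | succ k ih =>
    linear_combination (1 - X - treeSeries + X ^ k * treeSeries) * rootSeries_succ_mul k +
      (X + rootSeries (k + 1)) * ih

/-- The denominator of R_{k+2} contains T. Multiplication by its conjugate under T ↦ 1 - T, which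
exchanges the roots of y² - y + X = 0, makes it a polynomial. For index k + 2 this norm is divisible
by X², which is cancelled. -/
theorem two_mul_vertexSeries_mul (k : ℕ) :
    2 * vertexSeries (k + 2) * (1 + X ^ k - 3 * X ^ (k + 1) + X ^ (2 * k + 3)) =
      (1 - X) * X ^ (k + 1) *
        ((1 - 2 * X + X ^ (k + 2)) * centralSeries - (1 - X ^ (k + 2))) := by
  have hX : (X : ℝ⟦X⟧) ^ 2 ≠ 0 := pow_ne_zero _ X_ne_zero
  refine mul_left_cancel₀ hX ?_
  have hT := treeSeries_eq
  have hS := treeSeries_mul_centralSeries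
  have hF := vertexSeries_eq (k + 2)
  have hQ := rootSeries_mul (k + 2)
  set T := treeSeries
  set S := centralSeries
  set R := rootSeries (k + 2)
  set F := vertexSeries (k + 2)
  -- The norm of the denominator, as the product of the two conjugates.
  have hE : X ^ 2 * (1 + X ^ k - 3 * X ^ (k + 1) + X ^ (2 * k + 3)) =
      (1 - X - T + X ^ (k + 2) * T) * (1 - X - (1 - T) * (1 - X ^ (k + 2))) := by
    linear_combination -(1 - X ^ (k + 2)) ^ 2 * hT
  have hTT : T * (1 - T) = X := by linear_combination hT
  have hTS : 2 * ((1 - T) * S) = S + 1 := by linear_combination hS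
  calc X ^ 2 * (2 * F * (1 + X ^ k - 3 * X ^ (k + 1) + X ^ (2 * k + 3)))
      = 2 * F * (X ^ 2 * (1 + X ^ k - 3 * X ^ (k + 1) + X ^ (2 * k + 3))) := by ring
    _ = 2 * (1 - T) * S * (R * (1 - X - T + X ^ (k + 2) * T)) *
          (1 - X - (1 - T) * (1 - X ^ (k + 2))) := by rw [hE, hF]; ring
    _ = 2 * S * (1 - X) * X ^ (k + 2) * (T * (1 - T)) *
          (1 - X - (1 - T) * (1 - X ^ (k + 2))) := by rw [hQ]; ring
    _ = (1 - X) * X ^ (k + 3) *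
          (2 * S * (1 - X) - 2 * ((1 - T) * S) * (1 - X ^ (k + 2))) := by rw [hTT]; ring
    _ = _ := by rw [hTS]; ring

/-! ### The random vertex -/

/-- The two-stage choice is uniform on pointed trees because all trees of size `n` have the same
number of vertices. -/
theorem randomPointed_apply (n : ℕ+) (ω : Pointed n) :
    randomPointed n ω = (Fintype.card (OfSize n) : ENNReal)⁻¹ * ((n : ℕ) : ENNReal)⁻¹ := by
  classical
  obtain ⟨t, v⟩ := ω
  rw [randomPointed, PMF.bind_apply, tsum_eq_single t, PMF.map_apply, tsum_eq_single v]
  · have hcard : Fintype.card t.1.vertexSet = n := by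
      rw [← Nat.card_eq_fintype_card, Nat.card_coe_set_eq]
      exact t.2
    simp [PMF.uniformOfFintype_apply, hcard]
  · intro v' hv
    rw [if_neg]
    simpa using hv.symm
  · intro t' ht
    rw [PMF.map_apply, ENNReal.tsum_eq_zero.2, mul_zero]
    intro v'
    rw [if_neg]
    intro h
    exact ht (congrArg Pointed.tree h).symm

/-- Pointed trees as pairs. -/
def pointedEquiv (n : ℕ+) : Pointed n ≃ Σ t : OfSize n, t.1.vertexSet where
  toFun ω := ⟨ω.tree, ω.vertex⟩
  invFun p := ⟨p.1, p.2⟩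
  left_inv _ := rfl
  right_inv _ := rfl

noncomputable instance (n : ℕ+) : Fintype (Pointed n) := Fintype.ofEquiv _ (pointedEquiv n).symm

instance (n : ℕ+) : IsProbabilityMeasure (P n) := by
  unfold P
  infer_instance

theorem integral_P (n : ℕ+) (f : Pointed n → ℝ) :
    ∫ ω, f ω ∂(P n) =
      (∑ t : OfSize n, ∑ v : t.1.vertexSet, f ⟨t, v⟩) / (Fintype.card (OfSize n) * (n : ℕ)) := by
  rw [P, PMF.integral_eq_sum, ← (pointedEquiv n).symm.sum_comp, Fintype.sum_sigma, Finset.sum_div]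
  refine Finset.sum_congr rfl fun t _ => ?_
  rw [Finset.sum_div]
  refine Finset.sum_congr rfl fun v _ => ?_
  rw [randomPointed_apply]
  simp only [pointedEquiv, Equiv.coe_fn_symm_mk, ENNReal.toReal_mul, ENNReal.toReal_inv,
    ENNReal.toReal_natCast, smul_eq_mul]
  rw [div_eq_inv_mul, mul_inv]

/-- The probability that the protection number is at least `k`. -/
noncomputable def tailProb (n : ℕ+) (k : ℕ) : ℝ := (P n).real {ω | k ≤ Y n ω}

theorem sum_trees_eq_sum_ofSize (n : ℕ+) (w : PlaneTree → ℝ) :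
    ∑ t ∈ trees n, w t = ∑ t : OfSize n, w t.1 :=
  Finset.sum_subtype (trees n) (fun _ => mem_trees) w

theorem coeff_vertexSeries (n : ℕ+) (k : ℕ) :
    coeff n (vertexSeries k) =
      ∑ t : OfSize n, ∑ v : t.1.vertexSet, if k ≤ Y n ⟨t, v⟩ then (1 : ℝ) else 0 := by
  rw [vertexSeries, genFun, coeff_mk, sum_trees_eq_sum_ofSize]
  refine Finset.sum_congr rfl fun t _ => ?_
  rw [Finset.sum_boole, Nat.cast_inj, countProtected, ← Set.ncard_coe_finset,
    ← Set.ncard_image_of_injective _ Subtype.val_injective]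
  congr 1
  ext p
  constructor
  · rintro ⟨h1, h2⟩
    exact ⟨⟨p, h1⟩, Finset.mem_coe.2 (Finset.mem_filter.2 ⟨Finset.mem_univ _, h2⟩), rfl⟩
  · rintro ⟨v, hv, rfl⟩
    exact ⟨v.2, (Finset.mem_filter.1 (Finset.mem_coe.1 hv)).2⟩

theorem coeff_vertexSeries_zero (n : ℕ+) :
    coeff n (vertexSeries 0) = Fintype.card (OfSize n) * (n : ℕ) := by
  rw [vertexSeries, genFun, coeff_mk, sum_trees_eq_sum_ofSize]
  have : ∀ t : OfSize n, (countProtected 0 t.1 : ℝ) = (n : ℕ) := fun t => by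
    rw [countProtected_zero, t.2]
  simp [this]

/-- The denominator counts all pointed trees: it is the n-th coefficient of V_0 = X S. -/
theorem tailProb_eq (n : ℕ+) (k : ℕ) :
    tailProb n k = coeff n (vertexSeries k) / ((n : ℕ) - 1).centralBinom := by
  have h1 : coeff n (vertexSeries 0) = ((n : ℕ) - 1).centralBinom := by
    obtain ⟨m, hm⟩ := Nat.exists_eq_succ_of_ne_zero n.ne_zero
    rw [hm, vertexSeries_zero, coeff_succ_X_mul]
    simp [centralSeries]
  rw [← h1, coeff_vertexSeries_zero, coeff_vertexSeries, ← integral_P n fun ω =>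
    if k ≤ Y n ω then (1 : ℝ) else 0, tailProb, ← integral_indicator_one (by trivial)]
  simp [Set.indicator_apply]

theorem prob_eq_sub_tailProb (n : ℕ+) (k : ℕ) :
    (P n).real {ω | Y n ω = k} = tailProb n k - tailProb n (k + 1) := by
  have h : {ω | Y n ω = k} = {ω | k ≤ Y n ω} \ {ω | k + 1 ≤ Y n ω} := by
    ext ω
    simp only [Set.mem_ofPred_eq, Set.mem_sdiff]
    omega
  have hsub : {ω | k + 1 ≤ Y n ω} ⊆ {ω | k ≤ Y n ω} := fun ω hω => by
    simp only [Set.mem_ofPred_eq] at hω ⊢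
    omega
  rw [h, measureReal_sdiff hsub (by trivial)]
  rfl

/-- Summation by layers: the sum over k ≥ 1 of c_k times the indicator of k ≤ Y is the partial sum
of `c` up to Y. Weights 1 and 2k - 1 produce Y and Y². -/
theorem hasSum_mul_tailProb (n : ℕ+) (c : ℕ → ℝ) :
    HasSum (fun k : ℕ+ => c k * tailProb n k)
      (∫ ω, ∑ k ∈ Finset.range (Y n ω), c (k + 1) ∂(P n)) := by
  have h1 : ∀ ω : Pointed n, HasSum (fun k : ℕ+ => if (k : ℕ) ≤ Y n ω then c k else 0)
      (∑ k ∈ Finset.range (Y n ω), c (k + 1)) := by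
    intro ω
    rw [← Equiv.pnatEquivNat.symm.hasSum_iff]
    have : ∑ k ∈ Finset.range (Y n ω), c (k + 1) =
        ∑ k ∈ Finset.range (Y n ω), if k + 1 ≤ Y n ω then c (k + 1) else 0 :=
      Finset.sum_congr rfl fun k hk => by
        rw [if_pos]
        exact Finset.mem_range.1 hk
    rw [this]
    refine (hasSum_sum_of_ne_finset_zero fun k hk => ?_ :
      HasSum (fun k => if k + 1 ≤ Y n ω then c (k + 1) else 0) _)
    rw [if_neg]
    simpa using hk
  have h2 : ∀ k : ℕ+, c k * tailProb n k = (∑ t : OfSize n, ∑ v : t.1.vertexSet,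
      if (k : ℕ) ≤ Y n ⟨t, v⟩ then c k else 0) / (Fintype.card (OfSize n) * (n : ℕ)) := by
    intro k
    rw [← integral_P n fun ω => if (k : ℕ) ≤ Y n ω then c k else 0, tailProb,
      ← integral_indicator_one (by trivial), ← integral_const_mul]
    simp [Set.indicator_apply]
  simp only [h2, integral_P]
  exact (hasSum_sum fun t _ => hasSum_sum fun v _ => h1 ⟨t, v⟩).div_const _

theorem hasSum_integral_Y (n : ℕ+) :
    HasSum (fun k : ℕ+ => tailProb n k) (∫ ω, (Y n ω : ℝ) ∂(P n)) := by
  simpa using hasSum_mul_tailProb n fun _ => 1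

theorem hasSum_integral_Y_sq (n : ℕ+) :
    HasSum (fun k : ℕ+ => (2 * (k : ℝ) - 1) * tailProb n k) (∫ ω, (Y n ω : ℝ) ^ 2 ∂(P n)) := by
  have h : ∀ N : ℕ, ∑ k ∈ Finset.range N, (2 * ((k + 1 : ℕ) : ℝ) - 1) = (N : ℝ) ^ 2 := by
    intro N
    induction N with
    | zero => simp
    | succ N ih =>
      rw [Finset.sum_range_succ, ih]
      push_cast
      ring
  have := hasSum_mul_tailProb n fun k => 2 * (k : ℝ) - 1
  simpa only [h] using this

theorem variance_Y (n : ℕ+) :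
    variance (fun ω => (Y n ω : ℝ)) (P n) =
      (∫ ω, (Y n ω : ℝ) ^ 2 ∂(P n)) - (∫ ω, (Y n ω : ℝ) ∂(P n)) ^ 2 := by
  have : DiscreteMeasurableSpace (Pointed n) := ⟨fun _ => trivial⟩
  exact variance_eq_sub (MemLp.of_discrete)

/-! ### Power series with geometrically bounded coefficients -/

/-- The `j`-th coefficient of `A` is at most `c * 3 ^ j` in absolute value. -/
def GeomBounded (A : ℝ⟦X⟧) (c : ℝ) : Prop := ∀ j, |coeff j A| ≤ c * 3 ^ j

namespace GeomBounded

variable {A B : ℝ⟦X⟧} {c d : ℝ}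

theorem mono (hA : GeomBounded A c) (h : c ≤ d) : GeomBounded A d := fun j =>
  (hA j).trans (by gcongr)

theorem add (hA : GeomBounded A c) (hB : GeomBounded B d) : GeomBounded (A + B) (c + d) :=
  fun j => by
    rw [map_add, add_mul]
    exact (abs_add_le _ _).trans (add_le_add (hA j) (hB j))

theorem C_mul (hA : GeomBounded A c) (r : ℝ) : GeomBounded (C r * A) (|r| * c) := fun j => by
  rw [coeff_C_mul, abs_mul, mul_assoc]
  exact mul_le_mul_of_nonneg_left (hA j) (abs_nonneg r)

theorem sub (hA : GeomBounded A c) (hB : GeomBounded B d) : GeomBounded (A - B) (c + d) :=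
  fun j => by
    rw [map_sub, add_mul]
    exact (abs_sub _ _).trans (add_le_add (hA j) (hB j))

theorem nonneg (hA : GeomBounded A c) : 0 ≤ c := by
  simpa using (abs_nonneg _).trans (hA 0)

theorem X_pow_mul (hA : GeomBounded A c) (m : ℕ) : GeomBounded (X ^ m * A) (c / 3 ^ m) :=
  fun j => by
    rw [coeff_X_pow_mul']
    split_ifs with h
    · refine (hA _).trans (le_of_eq ?_)
      rw [pow_sub₀ _ (by norm_num) h]
      field_simp
    · have := hA.nonneg
      rw [abs_zero]
      positivity

end GeomBounded

/-- The denominator of the generating function of vertices of protection number at least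
`k + 2`. -/
noncomputable def denom (k : ℕ) : ℝ⟦X⟧ := 1 + X ^ k - 3 * X ^ (k + 1) + X ^ (2 * k + 3)

theorem denom_mul_inv (k : ℕ) : denom k * (denom k)⁻¹ = 1 := by
  refine PowerSeries.mul_inv_cancel _ ?_
  rcases k with _ | k <;> simp [denom]

theorem coeff_denom_inv (k j : ℕ) :
    coeff j (denom k)⁻¹ + coeff j (X ^ k * (denom k)⁻¹) - 3 * coeff j (X ^ (k + 1) * (denom k)⁻¹) +
      coeff j (X ^ (2 * k + 3) * (denom k)⁻¹) = if j = 0 then 1 else 0 := by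
  rw [← coeff_one, ← denom_mul_inv k, ← coeff_C_mul, map_ofNat C 3, ← map_add, ← map_sub, ← map_add]
  congr 1
  rw [denom]
  ring

/-- Strong induction on the recurrence `coeff_denom_inv`. For positive index the three earlier terms
contribute at most 1/3 + 3/9 + 1/9 < 1 in units of 3^j. -/
theorem geomBounded_denom_inv (k : ℕ) : GeomBounded (denom k)⁻¹ 1 := by
  intro j
  induction j using Nat.strong_induction_on with
  | _ j ih =>
    have hX : ∀ m, |coeff j (X ^ (m + 1) * (denom k)⁻¹)| ≤ 3 ^ j / 3 ^ (m + 1) := by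
      intro m
      rw [coeff_X_pow_mul']
      split_ifs with h
      · refine (ih _ (by omega)).trans (le_of_eq ?_)
        rw [pow_sub₀ _ (by norm_num) h]
        field_simp
      · rw [abs_zero]
        positivity
    rcases Nat.eq_zero_or_pos j with rfl | hj
    · rcases k with _ | k <;> simp [denom]
      norm_num
    have h := coeff_denom_inv k j
    rw [if_neg hj.ne'] at h
    have h3 : (0 : ℝ) < 3 ^ j := by positivity
    -- For index 0 the term X^0 joins the leading one, and the recurrence determines twice the j-th
    -- coefficient; it is treated separately.
    rcases k with _ | k
    · have h1 := abs_le.1 (hX 0)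
      have h2 := abs_le.1 (hX 2)
      simp only [pow_zero, one_mul, zero_add, mul_zero, Nat.reduceAdd] at h h1 h2
      simp only [pow_one] at h h1
      norm_num only [abs_le] at h2 ⊢
      constructor <;> linarith
    · have h1 := abs_le.1 (hX k)
      have h2 := abs_le.1 (hX (k + 1))
      have h4 := abs_le.1 (hX (2 * k + 4))
      rw [show 2 * (k + 1) + 3 = 2 * k + 4 + 1 by ring] at h
      have e1 : (3 : ℝ) ^ j / 3 ^ (k + 1) ≤ 3 ^ j / 3 := by
        gcongr
        exact le_self_pow₀ (by norm_num) (by omega)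
      have e2 : (3 : ℝ) ^ j / 3 ^ (k + 1 + 1) ≤ 3 ^ j / 9 := by
        gcongr
        calc (9 : ℝ) = 3 ^ 2 := by norm_num
          _ ≤ _ := pow_le_pow_right₀ (by norm_num) (by omega)
      have e4 : (3 : ℝ) ^ j / 3 ^ (2 * k + 4 + 1) ≤ 3 ^ j / 9 := by
        gcongr
        calc (9 : ℝ) = 3 ^ 2 := by norm_num
          _ ≤ _ := pow_le_pow_right₀ (by norm_num) (by omega)
      rw [abs_le]
      constructor <;> linarith

/-- The factor of the central binomial series in the generating function of vertices of
protection number at least `k + 2`. -/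
noncomputable def singularPart (k : ℕ) : ℝ⟦X⟧ :=
  C (1 / 2) * (X ^ k * ((1 - X) * ((1 - 2 * X + X ^ (k + 2)) * (denom k)⁻¹)))

/-- The part without square root singularity of the generating function of vertices of
protection number at least `k + 2`. -/
noncomputable def regularPart (k : ℕ) : ℝ⟦X⟧ :=
  C (1 / 2) * (X ^ k * ((1 - X) * ((1 - X ^ (k + 2)) * (denom k)⁻¹)))

theorem C_half_mul_two : (C (1 / 2) : ℝ⟦X⟧) * 2 = 1 := by
  rw [← map_ofNat C 2, ← map_mul]
  norm_num

theorem vertexSeries_add_two (k : ℕ) :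
    vertexSeries (k + 2) = X * (singularPart k * centralSeries - regularPart k) := by
  have h := two_mul_vertexSeries_mul k
  rw [← denom] at h
  have h1 := denom_mul_inv k
  have h2 := C_half_mul_two
  rw [singularPart, regularPart]
  linear_combination C (1 / 2) * (denom k)⁻¹ * h - 2 * C (1 / 2) * vertexSeries (k + 2) * h1 -
    vertexSeries (k + 2) * h2

theorem GeomBounded.one_sub_X_mul {A : ℝ⟦X⟧} {c : ℝ} (hA : GeomBounded A c) :
    GeomBounded ((1 - X) * A) (4 / 3 * c) := by
  have := hA.sub (hA.X_pow_mul 1)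
  rw [pow_one, ← one_sub_mul] at this
  exact this.mono (by linarith)

theorem geomBounded_singularPart (k : ℕ) : GeomBounded (singularPart k) (4 / 3 / 3 ^ k) := by
  have hV := geomBounded_denom_inv k
  have h1 : GeomBounded ((1 - 2 * X + X ^ (k + 2)) * (denom k)⁻¹) 2 := by
    have h2 := (hV.sub ((hV.X_pow_mul 1).C_mul 2)).add (hV.X_pow_mul (k + 2))
    have h3 : (denom k)⁻¹ - C 2 * (X ^ 1 * (denom k)⁻¹) + X ^ (k + 2) * (denom k)⁻¹ =
        (1 - 2 * X + X ^ (k + 2)) * (denom k)⁻¹ := by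
      rw [map_ofNat C 2]
      ring
    rw [h3] at h2
    refine h2.mono ?_
    have : (1 : ℝ) / 3 ^ (k + 2) ≤ 1 / 9 := by
      gcongr
      calc (9 : ℝ) = 3 ^ 2 := by norm_num
        _ ≤ _ := pow_le_pow_right₀ (by norm_num) (by omega)
    norm_num at this ⊢
    linarith
  refine ((h1.one_sub_X_mul.X_pow_mul k).C_mul (1 / 2)).mono (le_of_eq ?_)
  rw [abs_of_pos (by norm_num)]
  ring

theorem geomBounded_regularPart (k : ℕ) : GeomBounded (regularPart k) (4 / 3 / 3 ^ k) := by
  have hV := geomBounded_denom_inv k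
  have h1 : GeomBounded ((1 - X ^ (k + 2)) * (denom k)⁻¹) 2 := by
    have h2 := hV.sub (hV.X_pow_mul (k + 2))
    rw [← one_sub_mul] at h2
    refine h2.mono ?_
    have : (1 : ℝ) / 3 ^ (k + 2) ≤ 1 := by
      rw [div_le_one (by positivity)]
      exact one_le_pow₀ (by norm_num)
    linarith
  refine ((h1.one_sub_X_mul.X_pow_mul k).C_mul (1 / 2)).mono (le_of_eq ?_)
  rw [abs_of_pos (by norm_num)]
  ring

/-! ### Values and derivatives at `1 / 4` -/

/-- The power series `A` and `X` times its derivative converge at `1 / 4`, with the values `a` and `a'`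
respectively. -/
def HasValue (A : ℝ⟦X⟧) (a a' : ℝ) : Prop :=
  HasSum (fun j : ℕ => coeff j A * (1 / 4) ^ j) a ∧
    HasSum (fun j : ℕ => (j : ℝ) * (coeff j A * (1 / 4) ^ j)) a'

namespace HasValue

variable {A B : ℝ⟦X⟧} {a a' b b' : ℝ}

theorem unique (h : HasValue A a a') (h' : HasValue A b b') : a = b ∧ a' = b' :=
  ⟨h.1.unique h'.1, h.2.unique h'.2⟩

theorem add (hA : HasValue A a a') (hB : HasValue B b b') : HasValue (A + B) (a + b) (a' + b') := by
  constructor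
  · simpa [add_mul] using hA.1.add hB.1
  · simpa [add_mul, mul_add] using hA.2.add hB.2

theorem C_mul (hA : HasValue A a a') (r : ℝ) : HasValue (C r * A) (r * a) (r * a') := by
  constructor
  · simpa only [coeff_C_mul, mul_assoc] using hA.1.mul_left r
  · simpa only [coeff_C_mul, mul_assoc, mul_left_comm _ r] using hA.2.mul_left r

theorem X_pow_mul (hA : HasValue A a a') (m : ℕ) :
    HasValue (X ^ m * A) ((1 / 4) ^ m * a) ((1 / 4) ^ m * (a' + m * a)) := by
  have h0 : ∀ i ∈ Finset.range m, coeff i (X ^ m * A) = 0 := fun i hi => by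
    rw [coeff_X_pow_mul', if_neg (by simpa using hi)]
  constructor
  · have h1 := Finset.sum_eq_zero (s := Finset.range m)
      (f := fun j => coeff j (X ^ m * A) * (1 / 4 : ℝ) ^ j) fun i hi => by rw [h0 i hi, zero_mul]
    rw [← add_zero ((1 / 4) ^ m * a), ← h1, ← hasSum_nat_add_iff]
    have h2 : (fun j => coeff (j + m) (X ^ m * A) * (1 / 4 : ℝ) ^ (j + m)) =
        fun j => (1 / 4) ^ m * (coeff j A * (1 / 4) ^ j) := by
      funext j
      rw [coeff_X_pow_mul]
      ring
    rw [h2]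
    exact hA.1.mul_left _
  · have h1 := Finset.sum_eq_zero (s := Finset.range m)
      (f := fun j : ℕ => (j : ℝ) * (coeff j (X ^ m * A) * (1 / 4 : ℝ) ^ j))
      fun i hi => by rw [h0 i hi, zero_mul, mul_zero]
    rw [← add_zero ((1 / 4) ^ m * (a' + m * a)), ← h1, ← hasSum_nat_add_iff]
    have h2 : (fun j : ℕ => ((j + m : ℕ) : ℝ) *
        (coeff (j + m) (X ^ m * A) * (1 / 4 : ℝ) ^ (j + m))) = fun j : ℕ => (1 / 4) ^ m *
          ((j : ℝ) * (coeff j A * (1 / 4) ^ j) + m * (coeff j A * (1 / 4) ^ j)) := by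
      funext j
      rw [coeff_X_pow_mul]
      push_cast
      ring
    rw [h2]
    exact (hA.2.add (hA.1.mul_left (m : ℝ))).mul_left _

theorem one : HasValue 1 1 0 := by
  constructor
  · convert hasSum_ite_eq 0 (1 : ℝ) using 2 with j
    rw [coeff_one]
    split_ifs with h <;> simp [h]
  · convert hasSum_zero using 2 with j
    rw [coeff_one]
    split_ifs with h <;> simp [h]

end HasValue

theorem summable_pow_mul_three_div_four (p : ℕ) :
    Summable fun j : ℕ => (j : ℝ) ^ p * (3 / 4 : ℝ) ^ j :=
  summable_pow_mul_geometric_of_norm_lt_one p (by norm_num)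

/-- At 1/4 the terms are dominated by c (3/4)^j, even after multiplication by j. -/
theorem GeomBounded.exists_hasValue {A : ℝ⟦X⟧} {c : ℝ} (hA : GeomBounded A c) :
    ∃ a a', HasValue A a a' := by
  have h : ∀ j, |coeff j A * (1 / 4) ^ j| ≤ c * (3 / 4) ^ j := fun j => by
    rw [abs_mul, abs_of_pos (by positivity : (0 : ℝ) < (1 / 4) ^ j),
      show (3 / 4 : ℝ) = 3 * (1 / 4) by norm_num, mul_pow, ← mul_assoc]
    exact mul_le_mul_of_nonneg_right (hA j) (by positivity)
  refine ⟨_, _, (Summable.of_norm_bounded ?_ h).hasSum, (Summable.of_norm_bounded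
    ((summable_pow_mul_three_div_four 1).mul_left c) fun j => ?_).hasSum⟩
  · simpa using (summable_pow_mul_three_div_four 0).mul_left c
  · rw [norm_mul, Real.norm_natCast, pow_one, mul_left_comm]
    exact mul_le_mul_of_nonneg_left (h j) (Nat.cast_nonneg j)

/-- Convergence is known, so evaluating the polynomial identity 2 D A = X^k (1 - X)(1 - 2X +
X^(k+2)), with D = `denom k`, and X times its derivative at 1/4 gives two linear equations for the
two values. -/
theorem hasValue_singularPart (k : ℕ) :
    HasValue (singularPart k) (a (k + 2)) (2 * b (k + 2)) := by
  obtain ⟨y, y', hy⟩ := (geomBounded_singularPart k).exists_hasValue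
  have hL := (((hy.add (hy.X_pow_mul k)).add ((hy.X_pow_mul (k + 1)).C_mul (-3))).add
    (hy.X_pow_mul (2 * k + 3))).C_mul 2
  have hR := ((((HasValue.one.X_pow_mul k).add ((HasValue.one.X_pow_mul (k + 1)).C_mul (-3))).add
    ((HasValue.one.X_pow_mul (k + 2)).C_mul 2)).add (HasValue.one.X_pow_mul (2 * k + 2))).add
      ((HasValue.one.X_pow_mul (2 * k + 3)).C_mul (-1))
  have hLR : C 2 * (singularPart k + X ^ k * singularPart k +
      C (-3) * (X ^ (k + 1) * singularPart k) + X ^ (2 * k + 3) * singularPart k) =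
      X ^ k * 1 + C (-3) * (X ^ (k + 1) * 1) + C 2 * (X ^ (k + 2) * 1) + X ^ (2 * k + 2) * 1 +
        C (-1) * (X ^ (2 * k + 3) * 1) := by
    have h1 := denom_mul_inv k
    have h2 := C_half_mul_two
    have h3 : 2 * denom k * singularPart k = X ^ k * ((1 - X) * (1 - 2 * X + X ^ (k + 2))) := by
      rw [singularPart]
      linear_combination (C (1 / 2) * 2) * X ^ k * ((1 - X) * (1 - 2 * X + X ^ (k + 2))) * h1 +
        X ^ k * ((1 - X) * (1 - 2 * X + X ^ (k + 2))) * h2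
    rw [denom] at h3
    simp only [map_neg, map_ofNat, map_one]
    linear_combination h3
  rw [hLR] at hL
  obtain ⟨e1, e2⟩ := hL.unique hR
  have hx : (0 : ℝ) < 4 ^ k := by positivity
  simp only [pow_add, pow_mul', one_div, inv_pow] at e1 e2
  push_cast at e2
  have hy1 : y = a (k + 2) := by
    rw [a, pow_add]
    generalize (4 : ℝ) ^ k = x at *
    rw [eq_div_iff (by positivity)]
    field_simp at e1
    -- At 1/4 both T and 1 - T equal 1/2, so D(1/4) = (1 + 4^(-k)/8)² is a square; one of its
    -- factors also divides the right side and is cancelled.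
    have hne : x + 1 / 8 ≠ 0 := by positivity
    refine mul_left_cancel₀ hne ?_
    linear_combination e1 / 8
  have hy2 : y' = 2 * b (k + 2) := by
    rw [a, eq_div_iff (by positivity), pow_add] at hy1
    rw [b, pow_mul', pow_add]
    generalize (4 : ℝ) ^ k = x at *
    push_cast
    rw [mul_div_assoc', eq_div_iff (by positivity)]
    field_simp at e2
    linear_combination 8 * (8 * x + 1) * e2 -
      8 * (64 * x * k - 48 * x * (k + 1) + 2 * k + 3) * hy1
  rw [← hy1, ← hy2]
  exact hy

/-! ### Asymptotics of coefficients -/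

/-- The ratio of central binomial coefficients, normalized to tend to `1`. -/
noncomputable def centralRatio (m j : ℕ) : ℝ :=
  ((m - j).centralBinom : ℝ) * 4 ^ j / m.centralBinom

theorem centralBinom_cast_pos (m : ℕ) : (0 : ℝ) < m.centralBinom :=
  Nat.cast_pos.2 (Nat.centralBinom_pos m)

theorem centralRatio_zero (m : ℕ) : centralRatio m 0 = 1 := by
  have := (centralBinom_cast_pos m).ne'
  simp [centralRatio, this]

theorem centralRatio_nonneg (m j : ℕ) : 0 ≤ centralRatio m j := by
  unfold centralRatio
  positivity

theorem centralRatio_succ {m j : ℕ} (hj : j < m) :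
    (2 * ((m : ℝ) - j) - 1) * centralRatio m (j + 1) =
      2 * ((m : ℝ) - j) * centralRatio m j := by
  obtain ⟨i, rfl⟩ := Nat.exists_eq_add_of_lt hj
  have h1 : j + i + 1 - (j + 1) = i := by omega
  have h2 : j + i + 1 - j = i + 1 := by omega
  have h := Nat.succ_mul_centralBinom_succ i
  have h' : ((i : ℝ) + 1) * (i + 1).centralBinom = 2 * (2 * i + 1) * i.centralBinom := by
    exact_mod_cast h
  have := (centralBinom_cast_pos (j + i + 1)).ne'
  simp only [centralRatio, h1, h2]
  field_simp
  push_cast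
  linear_combination (-2 * 4 ^ j) * h'

/-- With i = m - j, the recurrence makes i times the ratio nonincreasing in j, because 2(i - 1) ≤ 2i
- 1. -/
theorem mul_centralRatio_le {m j : ℕ} (hj : j < m) : ((m : ℝ) - j) * centralRatio m j ≤ m := by
  induction j with
  | zero => simp [centralRatio_zero]
  | succ j ih =>
    have h1 := ih (by omega)
    have h2 := centralRatio_succ (m := m) (j := j) (by omega)
    have h3 : (j : ℝ) + 2 ≤ m := by exact_mod_cast hj
    have h4 := centralRatio_nonneg m (j + 1)
    push_cast
    nlinarith

theorem one_le_centralRatio {m j : ℕ} (hj : j ≤ m) : 1 ≤ centralRatio m j := by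
  induction j with
  | zero => simp [centralRatio_zero]
  | succ j ih =>
    have h1 := ih (by omega)
    have h2 := centralRatio_succ (m := m) (j := j) (by omega)
    have h3 : (j : ℝ) + 1 ≤ m := by exact_mod_cast hj
    have h4 : 0 < 2 * ((m : ℝ) - j) - 1 := by linarith
    nlinarith

theorem centralRatio_succ_sub_bounds {m j : ℕ} (hj : j < m) :
    0 ≤ centralRatio m (j + 1) - centralRatio m j - 1 / (2 * (m + 1)) ∧
      centralRatio m (j + 1) - centralRatio m j - 1 / (2 * (m + 1)) ≤
        3 * (j + 1) ^ 3 / (m : ℝ) ^ 2 := by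
  have h2 := centralRatio_succ hj
  have hx1 := one_le_centralRatio hj.le
  have hx2 := mul_centralRatio_le hj
  have h3 : (j : ℝ) + 1 ≤ m := by exact_mod_cast hj
  have hj0 : (0 : ℝ) ≤ j := Nat.cast_nonneg j
  have hm : (0 : ℝ) < m := by linarith
  set x := centralRatio m j
  set x' := centralRatio m (j + 1)
  obtain ⟨i, hi⟩ : ∃ i : ℝ, i = m - j := ⟨_, rfl⟩
  rw [← hi] at h2 hx2
  have hi1 : 1 ≤ i := by linarith
  have hpos : 0 < 2 * i - 1 := by linarith
  have hd : x' - x = x / (2 * i - 1) := by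
    rw [eq_div_iff hpos.ne']
    linarith
  have him : (m : ℝ) ≤ i * (j + 1) := by nlinarith
  have hinv : 1 / (2 * i - 1) ≤ (j + 1) / m := by
    rw [div_le_div_iff₀ hpos hm]
    nlinarith
  have hx3 : x - 1 ≤ j * ((j + 1) / m) := by
    have : x - 1 ≤ j / i := by
      rw [le_div_iff₀ (by linarith)]
      linarith
    refine this.trans ?_
    rw [div_eq_mul_one_div]
    refine mul_le_mul_of_nonneg_left ?_ hj0
    rw [div_le_div_iff₀ (by linarith) hm]
    linarith
  -- The increment is x/(2i - 1). Replace x by 1, then 2i - 1 by 2(m + 1); these differ by 2j + 3.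
  -- Both errors are nonnegative.
  have hsplit : x' - x - 1 / (2 * (m + 1)) =
      (x - 1) * (1 / (2 * i - 1)) + (2 * j + 3) * (1 / (2 * i - 1)) * (1 / (2 * (m + 1))) := by
    rw [hd, hi]
    rw [hi] at hpos
    have := hpos.ne'
    field_simp
    ring
  have hinv0 : 0 ≤ 1 / (2 * i - 1) := by positivity
  rw [hsplit]
  constructor
  · have : 0 ≤ x - 1 := by linarith
    positivity
  · calc (x - 1) * (1 / (2 * i - 1)) + (2 * j + 3) * (1 / (2 * i - 1)) * (1 / (2 * (m + 1)))
        ≤ j * ((j + 1) / m) * ((j + 1) / m) + (2 * j + 3) * ((j + 1) / m) * (1 / (2 * m)) := by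
          gcongr
          linarith
      _ = (j * (j + 1) ^ 2 + (j + 3 / 2) * (j + 1)) / (m : ℝ) ^ 2 := by
          field_simp
      _ ≤ 3 * (j + 1) ^ 3 / (m : ℝ) ^ 2 := by
          gcongr
          nlinarith [mul_nonneg hj0 hj0, mul_nonneg hj0 (mul_nonneg hj0 hj0)]

/-- Summing the increments: j⁴ + (j + 1)³ ≤ (j + 1)⁴. -/
theorem abs_centralRatio_sub_le {m j : ℕ} (hj : j ≤ m) :
    |centralRatio m j - 1 - j / (2 * (m + 1))| ≤ 3 * (j : ℝ) ^ 4 / (m : ℝ) ^ 2 := by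
  suffices 0 ≤ centralRatio m j - 1 - j / (2 * (m + 1)) ∧
      centralRatio m j - 1 - j / (2 * (m + 1)) ≤ 3 * (j : ℝ) ^ 4 / (m : ℝ) ^ 2 by
    rw [abs_of_nonneg this.1]
    exact this.2
  induction j with
  | zero => simp [centralRatio_zero]
  | succ j ih =>
    obtain ⟨h1, h2⟩ := ih (by omega)
    obtain ⟨h3, h4⟩ := centralRatio_succ_sub_bounds (m := m) (j := j) (by omega)
    have e : ((j + 1 : ℕ) : ℝ) / (2 * (m + 1)) = j / (2 * (m + 1)) + 1 / (2 * (m + 1)) := by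
      push_cast
      ring
    rw [e]
    refine ⟨by linarith, ?_⟩
    calc centralRatio m (j + 1) - 1 - (j / (2 * (m + 1)) + 1 / (2 * (m + 1)))
        ≤ 3 * (j : ℝ) ^ 4 / (m : ℝ) ^ 2 + 3 * (j + 1) ^ 3 / (m : ℝ) ^ 2 := by linarith
      _ = 3 * ((j : ℝ) ^ 4 + (j + 1) ^ 3) / (m : ℝ) ^ 2 := by ring
      _ ≤ _ := by
        push_cast
        gcongr
        have : (0 : ℝ) ≤ j := Nat.cast_nonneg j
        nlinarith [pow_nonneg this 2, pow_nonneg this 3]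

/-- The constant in the error bounds. -/
noncomputable def errorConst : ℝ := ∑' j : ℕ, 12 * ((j : ℝ) ^ 4 * (3 / 4) ^ j)

theorem hasSum_errorConst : HasSum (fun j : ℕ => 12 * ((j : ℝ) ^ 4 * (3 / 4) ^ j)) errorConst :=
  ((summable_pow_mul_three_div_four 4).mul_left 12).hasSum

/-- Extends the estimate to all j, so that the convolution can be compared with the full series at
1/4. For j > m the approximation itself is small against j⁴/(m+1)²; the factor 12 = 3 · 4 comes from
(m+1)² ≤ 4m². -/
theorem abs_ite_centralRatio_sub_le {m : ℕ} (hm : 1 ≤ m) (j : ℕ) :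
    |(if j ≤ m then centralRatio m j else 0) - 1 - j / (2 * (m + 1))| ≤
      12 * (j : ℝ) ^ 4 / ((m : ℝ) + 1) ^ 2 := by
  have hm' : (1 : ℝ) ≤ m := by exact_mod_cast hm
  split_ifs with h
  · refine (abs_centralRatio_sub_le h).trans ?_
    rw [div_le_div_iff₀ (by positivity) (by positivity)]
    have : ((m : ℝ) + 1) ^ 2 ≤ 4 * m ^ 2 := by nlinarith
    calc 3 * (j : ℝ) ^ 4 * ((m : ℝ) + 1) ^ 2 ≤ 3 * (j : ℝ) ^ 4 * (4 * m ^ 2) := by gcongr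
      _ = _ := by ring
  · have hj : (m : ℝ) + 1 ≤ j := by exact_mod_cast Nat.lt_of_not_le h
    have hj1 : (1 : ℝ) ≤ j := by linarith
    have e : (0 : ℝ) - 1 - j / (2 * (m + 1)) = -(1 + j / (2 * (m + 1))) := by ring
    rw [e, abs_neg, abs_of_pos (by positivity)]
    have h1 : (1 : ℝ) + j / (2 * (m + 1)) ≤ 1 + j := by
      gcongr
      exact div_le_self (by linarith) (by linarith)
    refine h1.trans ?_
    rw [le_div_iff₀ (by positivity)]
    calc (1 + (j : ℝ)) * ((m : ℝ) + 1) ^ 2 ≤ (j + j) * (j : ℝ) ^ 2 := by gcongr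
      _ = 2 * (j : ℝ) ^ 3 := by ring
      _ ≤ 12 * (j : ℝ) ^ 4 := by
        gcongr
        · norm_num
        · norm_num

/-- The transfer step: the normalized convolution is the sum of `coeff j A * (1 / 4) ^ j` times the
ratio, and the ratio's first-order expansion turns the main terms into α and α'. The error is
dominated termwise by the series of `errorConst`. -/
theorem coeff_mul_centralSeries_expansion {A : ℝ⟦X⟧} {c α α' : ℝ} (hA : GeomBounded A c)
    (hv : HasValue A α α') {m : ℕ} (hm : 1 ≤ m) :
    |coeff m (A * centralSeries) / m.centralBinom - (α + α' / (2 * (m + 1)))| ≤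
      c * errorConst / ((m : ℝ) + 1) ^ 2 := by
  have hc := (centralBinom_cast_pos m).ne'
  have h1 : HasSum (fun j => coeff j A * (1 / 4) ^ j * if j ≤ m then centralRatio m j else 0)
      (coeff m (A * centralSeries) / m.centralBinom) := by
    have : coeff m (A * centralSeries) / m.centralBinom = ∑ j ∈ Finset.range (m + 1),
        coeff j A * (1 / 4) ^ j * if j ≤ m then centralRatio m j else 0 := by
      rw [coeff_mul, Finset.Nat.sum_antidiagonal_eq_sum_range_succ
        (fun i j => coeff i A * coeff j centralSeries), Finset.sum_div]
      refine Finset.sum_congr rfl fun j hj => ?_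
      have hj' : j ≤ m := Nat.lt_succ_iff.1 (Finset.mem_range.1 hj)
      rw [if_pos hj', centralRatio, centralSeries, coeff_mk, one_div, inv_pow]
      field_simp
    rw [this]
    refine hasSum_sum_of_ne_finset_zero fun j hj => ?_
    rw [if_neg (by simpa using hj), mul_zero]
  have h2 : HasSum (fun j : ℕ => coeff j A * (1 / 4) ^ j *
      ((if j ≤ m then centralRatio m j else 0) - 1 - j / (2 * (m + 1))))
      (coeff m (A * centralSeries) / m.centralBinom - (α + α' / (2 * (m + 1)))) := by
    have e : (fun j : ℕ => coeff j A * (1 / 4) ^ j *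
        ((if j ≤ m then centralRatio m j else 0) - 1 - j / (2 * (m + 1)))) =
        fun j : ℕ => (coeff j A * (1 / 4) ^ j * if j ≤ m then centralRatio m j else 0) -
          (coeff j A * (1 / 4) ^ j + j * (coeff j A * (1 / 4) ^ j) / (2 * ((m : ℝ) + 1))) := by
      funext j
      ring
    rw [e]
    exact h1.sub (hv.1.add (hv.2.div_const (2 * ((m : ℝ) + 1))))
  have h3 := hasSum_errorConst.mul_left (c / ((m : ℝ) + 1) ^ 2)
  rw [← h2.tsum_eq, ← Real.norm_eq_abs]
  convert tsum_of_norm_bounded h3 fun j => ?_ using 1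
  · ring
  · rw [Real.norm_eq_abs, abs_mul, abs_mul, abs_of_pos (by positivity : (0 : ℝ) < (1 / 4) ^ j)]
    calc |coeff j A| * (1 / 4) ^ j *
          |(if j ≤ m then centralRatio m j else 0) - 1 - j / (2 * (m + 1))|
        ≤ c * 3 ^ j * (1 / 4) ^ j * (12 * (j : ℝ) ^ 4 / ((m : ℝ) + 1) ^ 2) := by
          have := hA.nonneg
          gcongr
          · exact hA j
          · exact abs_ite_centralRatio_sub_le hm j
      _ = c / ((m : ℝ) + 1) ^ 2 * (12 * ((j : ℝ) ^ 4 * (3 / 4) ^ j)) := by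
          rw [show (3 / 4 : ℝ) = 3 * (1 / 4) by norm_num, mul_pow]
          ring

/-- Since 4^m ≤ 2m times the central binomial coefficient, the quotient is at most 2cm (3/4)^m; a
single term of `errorConst` absorbs this. -/
theorem GeomBounded.abs_coeff_div_le {A : ℝ⟦X⟧} {c : ℝ} (hA : GeomBounded A c) {m : ℕ}
    (hm : 1 ≤ m) :
    |coeff m A / m.centralBinom| ≤ c * errorConst / ((m : ℝ) + 1) ^ 2 := by
  have hc := centralBinom_cast_pos m
  have hc0 := hA.nonneg
  have hm' : (1 : ℝ) ≤ m := by exact_mod_cast hm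
  have h1 : (4 : ℝ) ^ m ≤ 2 * m * m.centralBinom := by
    exact_mod_cast Nat.four_pow_le_two_mul_self_mul_centralBinom m hm
  have h2 : 12 * ((m : ℝ) ^ 4 * (3 / 4) ^ m) ≤ errorConst :=
    le_hasSum hasSum_errorConst m fun j _ => by positivity
  rw [abs_div, abs_of_pos hc, div_le_div_iff₀ hc (by positivity)]
  calc |coeff m A| * ((m : ℝ) + 1) ^ 2 ≤ c * 3 ^ m * (2 * m) ^ 2 := by
        gcongr
        · exact hA m
        · linarith
    _ = c * (4 * (m : ℝ) ^ 2 * (3 / 4) ^ m) * 4 ^ m := by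
        rw [div_pow]
        field_simp
        norm_num
    _ ≤ c * (4 * (m : ℝ) ^ 2 * (3 / 4) ^ m) * (2 * m * m.centralBinom) := by gcongr
    _ = c * (8 * (m : ℝ) ^ 3 * (3 / 4) ^ m) * m.centralBinom := by ring
    _ ≤ c * (12 * (m : ℝ) ^ 4 * (3 / 4) ^ m) * m.centralBinom := by
        gcongr
        · norm_num
        · norm_num
    _ ≤ c * errorConst * m.centralBinom := by
        gcongr
        linarith

/-! ### Expansion of the tail probabilities -/

theorem tailProb_zero (n : ℕ+) : tailProb n 0 = 1 := by
  simp [tailProb]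

theorem tailProb_one {n : ℕ+} (hn : 2 ≤ n) : tailProb n 1 = 1 / 2 := by
  have hn' : 2 ≤ (n : ℕ) := by exact_mod_cast hn
  obtain ⟨m, hm⟩ : ∃ m, (n : ℕ) = m + 2 := ⟨n - 2, by omega⟩
  have h := congrArg (coeff (m + 2)) two_mul_vertexSeries_one
  rw [show (2 : ℝ⟦X⟧) = C 2 from (map_ofNat C 2).symm, coeff_C_mul, coeff_succ_X_mul, map_sub,
    coeff_one, if_neg (Nat.succ_ne_zero m), sub_zero] at h
  have hc := (centralBinom_cast_pos (m + 1)).ne'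
  rw [tailProb_eq, hm]
  simp only [centralSeries, coeff_mk] at h
  rw [show m + 2 - 1 = m + 1 from rfl, div_eq_div_iff hc two_ne_zero]
  linarith

theorem a_zero : a 0 = 1 := by norm_num [a]

theorem b_zero : b 0 = 0 := by norm_num [b]

theorem a_one : a 1 = 1 / 2 := by norm_num [a]

theorem b_one : b 1 = 0 := by norm_num [b]

theorem errorConst_nonneg : 0 ≤ errorConst := hasSum_errorConst.nonneg fun j => by positivity

theorem abs_tailProb_sub_le {n : ℕ+} (hn : 2 ≤ n) (k : ℕ) :
    |tailProb n k - (a k + b k * (1 / ((n : ℕ) : ℝ)))| ≤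
      24 * errorConst * ((1 / 3) ^ k / ((n : ℕ) : ℝ) ^ 2) := by
  have h0 : 0 ≤ 24 * errorConst * ((1 / 3) ^ k / ((n : ℕ) : ℝ) ^ 2) := by
    have := errorConst_nonneg
    positivity
  rcases k with _ | _ | k
  · simpa [tailProb_zero, a_zero, b_zero] using h0
  · simpa [tailProb_one hn, a_one, b_one] using h0
  · have hn' : 2 ≤ (n : ℕ) := by exact_mod_cast hn
    obtain ⟨m, hm⟩ : ∃ m, (n : ℕ) = m + 1 := ⟨n - 1, by omega⟩
    have hm1 : 1 ≤ m := by omega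
    rw [tailProb_eq, hm, vertexSeries_add_two, coeff_succ_X_mul, Nat.add_sub_cancel, map_sub,
      sub_div]
    have h1 := coeff_mul_centralSeries_expansion (geomBounded_singularPart k)
      (hasValue_singularPart k) hm1
    have h2 := (geomBounded_regularPart k).abs_coeff_div_le hm1
    have e1 : 2 * b (k + 2) / (2 * ((m : ℝ) + 1)) = b (k + 2) * (1 / ((m + 1 : ℕ) : ℝ)) := by
      push_cast
      field_simp
    rw [e1] at h1
    -- The constant is 24 = 2 · (4/3) · 3²: two error terms, and the index shift from k to k + 2.
    have e2 : 24 * errorConst * ((1 / 3) ^ (k + 2) / ((m + 1 : ℕ) : ℝ) ^ 2) =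
        2 * (4 / 3 / 3 ^ k * errorConst / ((m : ℝ) + 1) ^ 2) := by
      rw [one_div_pow, pow_add]
      push_cast
      field_simp
      ring
    rw [e2]
    rw [abs_le] at h1 h2 ⊢
    constructor <;> linarith [h1.1, h1.2, h2.1, h2.2]

/-! ### The constants -/

theorem sq_le_three_mul_two_pow (k : ℕ) : ((k : ℝ) + 1) ^ 2 ≤ 3 * 2 ^ k := by
  have h : ∀ k : ℕ, (k + 1) ^ 2 ≤ 3 * 2 ^ k := by
    intro k
    induction k with
    | zero => norm_num
    | succ k ih =>
      -- The step (k+2)² ≤ 2(k+1)² requires k ≥ 2.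
      rcases k with _ | _ | k
      · norm_num
      · norm_num
      · have h : (k + 1 + 1 + 1 + 1) ^ 2 ≤ 2 * (k + 1 + 1 + 1) ^ 2 :=
          Nat.le.intro (k := k ^ 2 + 4 * k + 2) (by ring)
        rw [pow_succ 2 (k + 1 + 1)]
        linarith
  exact_mod_cast h k

theorem add_one_sq_div_le (k : ℕ) : ((k : ℝ) + 1) ^ 2 / 4 ^ k ≤ 3 * (1 / 2) ^ k := by
  rw [div_le_iff₀ (by positivity), mul_assoc, ← mul_pow]
  rw [show (1 / 2 * 4 : ℝ) = 2 by norm_num]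
  exact sq_le_three_mul_two_pow k

theorem abs_weight_mul_le {k : ℕ} {w y : ℝ} (hw : |w| ≤ 2 * (k + 1))
    (hy : |y| ≤ 26 * (k + 1) / 4 ^ k) : |w * y| ≤ 156 * (1 / 2) ^ k := by
  rw [abs_mul]
  calc |w| * |y| ≤ 2 * (k + 1) * (26 * (k + 1) / 4 ^ k) := by gcongr
    _ = 52 * (((k : ℝ) + 1) ^ 2 / 4 ^ k) := by ring
    _ ≤ 52 * (3 * (1 / 2) ^ k) := by
      gcongr
      exact add_one_sq_div_le k
    _ = _ := by ring

theorem abs_a_le (k : ℕ) : |a k| ≤ 26 * (k + 1) / 4 ^ k := by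
  have hk : (0 : ℝ) ≤ k := Nat.cast_nonneg k
  rw [a, abs_of_pos (by positivity)]
  gcongr
  · linarith
  · linarith

theorem abs_b_le (k : ℕ) : |b k| ≤ 26 * (k + 1) / 4 ^ k := by
  have hk : (0 : ℝ) ≤ k := Nat.cast_nonneg k
  have hx : (1 : ℝ) ≤ 4 ^ k := one_le_pow₀ (by norm_num)
  rw [b, pow_mul']
  generalize (4 : ℝ) ^ k = x at *
  have hx2 : x ≤ x ^ 2 := by nlinarith
  have hx1 : 1 ≤ x ^ 2 := by nlinarith
  have h1 : |(3 * (k : ℝ) - 10) * x ^ 2 + (6 * k + 26) * x - 16| ≤ 52 * (k + 1) * x ^ 2 := by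
    have e1 : (6 * (k : ℝ) + 26) * x ≤ (6 * k + 26) * x ^ 2 := by gcongr
    have e2 : 0 ≤ (k : ℝ) * x ^ 2 := by positivity
    have e3 : 0 ≤ (6 * (k : ℝ) + 26) * x := by positivity
    rw [abs_le]
    constructor <;> nlinarith
  rw [abs_div, abs_of_pos (by positivity : 0 < 2 * (x + 2) ^ 3),
    div_le_div_iff₀ (by positivity) (by positivity)]
  calc |(3 * (k : ℝ) - 10) * x ^ 2 + (6 * k + 26) * x - 16| * x
      ≤ 52 * (k + 1) * x ^ 2 * x := by gcongr
    _ = 26 * (k + 1) * (2 * x ^ 3) := by ring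
    _ ≤ _ := by
      gcongr
      linarith

theorem abs_one_le (k : ℕ) : |(1 : ℝ)| ≤ 2 * (k + 1) := by
  have hk : (0 : ℝ) ≤ k := Nat.cast_nonneg k
  rw [abs_one]
  linarith

theorem abs_two_mul_sub_one_le (k : ℕ) : |2 * (k : ℝ) - 1| ≤ 2 * (k + 1) := by
  have hk : (0 : ℝ) ≤ k := Nat.cast_nonneg k
  rw [abs_le]
  constructor <;> linarith

theorem summable_of_abs_le {f : ℕ → ℝ} {M : ℝ} (h : ∀ k, |f k| ≤ M * (1 / 2) ^ k) :
    Summable fun k : ℕ+ => f k := by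
  have : Summable f := Summable.of_norm_bounded
    ((summable_geometric_of_lt_one (by norm_num) (by norm_num)).mul_left M) h
  exact this.comp_injective PNat.coe_injective

/-- The sum of the first `N` values of `num k / den k` for `k ≥ 1`, in units of `10 ^ (-66)`,
each rounded down. -/
def roundedSum (num : ℕ → ℤ) (den : ℕ → ℕ) : ℕ → ℤ
  | 0 => 0
  | N + 1 => roundedSum num den N + 10 ^ 66 * num (N + 1) / (den (N + 1) : ℤ)

theorem abs_sum_sub_roundedSum_le {f : ℕ → ℝ} {num : ℕ → ℤ} {den : ℕ → ℕ}
    (hden : ∀ k, 0 < den k) (hf : ∀ k, f k = num k / den k) (N : ℕ) :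
    |10 ^ 66 * ∑ k ∈ Finset.range N, f (k + 1) - (roundedSum num den N : ℝ)| ≤ (N : ℝ) := by
  induction N with
  | zero => simp [roundedSum]
  | succ N ih =>
    rw [Finset.sum_range_succ, roundedSum, hf]
    have hd : (0 : ℤ) < den (N + 1) := by exact_mod_cast hden _
    have hd' : (0 : ℝ) < den (N + 1) := by exact_mod_cast hden _
    have h1 := Int.ediv_mul_le (10 ^ 66 * num (N + 1)) hd.ne'
    have h2 := Int.lt_ediv_add_one_mul_self (10 ^ 66 * num (N + 1)) hd
    generalize 10 ^ 66 * num (N + 1) / (den (N + 1) : ℤ) = q at *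
    have h1' : (q : ℝ) ≤ 10 ^ 66 * num (N + 1) / den (N + 1) := by
      rw [le_div_iff₀ hd']
      exact_mod_cast h1
    have h2' : 10 ^ 66 * num (N + 1) / den (N + 1) ≤ (q : ℝ) + 1 := by
      rw [div_le_iff₀ hd']
      exact_mod_cast h2.le
    rw [mul_div_assoc] at h1' h2'
    rw [abs_le] at ih ⊢
    push_cast
    constructor <;> linarith [ih.1, ih.2]

/-- Rounding 220 terms costs at most 220 · 10^(-66), and the remaining tail at most 156 · 2^(-220) <
10^(-64). -/
theorem abs_tsum_sub_roundedSum_le {f : ℕ → ℝ} {num : ℕ → ℤ} {den : ℕ → ℕ}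
    (hden : ∀ k, 0 < den k) (hf : ∀ k, f k = num k / den k)
    (hb : ∀ k, |f k| ≤ 156 * (1 / 2) ^ k) :
    |∑' k : ℕ+, f k - roundedSum num den 220 / 10 ^ 66| ≤ 1 / 10 ^ 63 := by
  have hsum : Summable fun k => f (k + 1) :=
    (summable_nat_add_iff 1).2 (Summable.of_norm_bounded
      ((summable_geometric_of_lt_one (by norm_num) (by norm_num)).mul_left 156) hb)
  have h1 := abs_sum_sub_roundedSum_le hden hf 220
  have hgeom : HasSum (fun k : ℕ => 156 * (1 / 2) ^ 221 * (1 / 2 : ℝ) ^ k)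
      (156 * (1 / 2) ^ 221 * 2) := hasSum_geometric_two.mul_left _
  have h2 : |∑' k, f (k + 220 + 1)| ≤ 156 * (1 / 2) ^ 221 * 2 := by
    refine tsum_of_norm_bounded (f := fun k => f (k + 220 + 1)) hgeom fun k =>
      (hb _).trans (le_of_eq ?_)
    rw [add_assoc, pow_add]
    ring
  rw [tsum_pnat_eq_tsum_succ (f := f), ← hsum.sum_add_tsum_nat_add 220]
  have h3 : (156 * (1 / 2) ^ 221 * 2 : ℝ) ≤ 1 / 10 ^ 64 := by norm_num
  generalize ∑ k ∈ Finset.range 220, f (k + 1) = s at *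
  generalize ∑' k, f (k + 220 + 1) = t at *
  generalize (roundedSum num den 220 : ℝ) = r at *
  rw [abs_le] at h1 h2 ⊢
  norm_num only at *
  constructor <;> linarith [h1.1, h1.2, h2.1, h2.2]

/-- The numerator of `a k`. -/
def aNum (_ : ℕ) : ℤ := 3

/-- The denominator of `a k`. -/
def aDen (k : ℕ) : ℕ := 4 ^ k + 2

/-- The numerator of `b k`. -/
def bNum (k : ℕ) : ℤ := (3 * (k : ℤ) - 10) * (4 ^ (2 * k) : ℕ) + (6 * k + 26) * (4 ^ k : ℕ) - 16

/-- The denominator of `b k`. -/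
def bDen (k : ℕ) : ℕ := 2 * (4 ^ k + 2) ^ 3

theorem aDen_pos (k : ℕ) : 0 < aDen k := by
  unfold aDen
  positivity

theorem bDen_pos (k : ℕ) : 0 < bDen k := by
  unfold bDen
  positivity

theorem a_eq (k : ℕ) : a k = aNum k / aDen k := by
  simp [a, aNum, aDen]

theorem b_eq (k : ℕ) : b k = bNum k / bDen k := by
  simp [b, bNum, bDen]

theorem roundedSum_a : roundedSum aNum aDen 220 =
    727649276913726097531184400482145348863515722775042276537007958415 := by
  decide +kernel

theorem roundedSum_b : roundedSum bNum bDen 220 =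
    -31183712598622277494524648993610043742589912871352172530717409107 := by
  decide +kernel

theorem roundedSum_weighted_a : roundedSum (fun k => (2 * k - 1) * aNum k) aDen 220 =
    1346372849676697366285430870409451570812063606817172153259580066928 := by
  decide +kernel

theorem roundedSum_weighted_b : roundedSum (fun k => (2 * k - 1) * bNum k) bDen 220 =
    -53450918697323314110531205697658909427009721734610714508004063372 := by
  decide +kernel

theorem abs_tsum_a_sub_le :
    |∑' k : ℕ+, a k - 727649276913726097531184400482145348863515722775042276537007958415 / 10 ^ 66|
      ≤ 1 / 10 ^ 63 := by
  have h := abs_tsum_sub_roundedSum_le aDen_pos a_eq fun k => by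
    simpa using abs_weight_mul_le (abs_one_le k) (abs_a_le k)
  rw [roundedSum_a] at h
  push_cast at h
  exact h

theorem abs_tsum_b_sub_le :
    |∑' k : ℕ+, b k - (-31183712598622277494524648993610043742589912871352172530717409107) / 10 ^ 66|
      ≤ 1 / 10 ^ 63 := by
  have h := abs_tsum_sub_roundedSum_le bDen_pos b_eq fun k => by
    simpa using abs_weight_mul_le (abs_one_le k) (abs_b_le k)
  rw [roundedSum_b] at h
  push_cast at h
  exact h

theorem abs_tsum_weighted_a_sub_le :
    |∑' k : ℕ+, (2 * (k : ℝ) - 1) * a k -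
        1346372849676697366285430870409451570812063606817172153259580066928 / 10 ^ 66| ≤ 1 / 10 ^ 63 := by
  have h := abs_tsum_sub_roundedSum_le (f := fun k => (2 * (k : ℝ) - 1) * a k)
    (num := fun k => (2 * k - 1) * aNum k) aDen_pos
    (fun k => by rw [a_eq]; push_cast; ring)
    fun k => abs_weight_mul_le (abs_two_mul_sub_one_le k) (abs_a_le k)
  rw [roundedSum_weighted_a] at h
  push_cast at h
  exact h

theorem abs_tsum_weighted_b_sub_le :
    |∑' k : ℕ+, (2 * (k : ℝ) - 1) * b k -
        (-53450918697323314110531205697658909427009721734610714508004063372) / 10 ^ 66| ≤ 1 / 10 ^ 63 := by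
  have h := abs_tsum_sub_roundedSum_le (f := fun k => (2 * (k : ℝ) - 1) * b k)
    (num := fun k => (2 * k - 1) * bNum k) bDen_pos
    (fun k => by rw [b_eq]; push_cast; ring)
    fun k => abs_weight_mul_le (abs_two_mul_sub_one_le k) (abs_b_le k)
  rw [roundedSum_weighted_b] at h
  push_cast at h
  exact h

theorem abs_mul_sub_mul_le {x y u v ε : ℝ} (hx : |x - u| ≤ ε) (hy : |y - v| ≤ ε)
    (hu : |u| ≤ 1) (hv : |v| ≤ 1) (hε : ε ≤ 1) : |x * y - u * v| ≤ 3 * ε := by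
  have hε0 : 0 ≤ ε := (abs_nonneg _).trans hx
  have e : x * y - u * v = (x - u) * (y - v) + u * (y - v) + (x - u) * v := by ring
  rw [e]
  calc |(x - u) * (y - v) + u * (y - v) + (x - u) * v|
      ≤ |x - u| * |y - v| + |u| * |y - v| + |x - u| * |v| := by
        simpa only [abs_mul] using abs_add_three ((x - u) * (y - v)) (u * (y - v)) ((x - u) * v)
    _ ≤ ε * 1 + 1 * ε + ε * 1 := by
        gcongr
        exact hy.trans hε
    _ = 3 * ε := by ring

theorem abs_d₀_sub_lt :
    |d₀ - 0.727649276913726097531184400482145348863515722775042276537008| < 1 / 10 ^ 60 := by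
  have h := abs_le.1 abs_tsum_a_sub_le
  rw [abs_lt, d₀]
  norm_num only at *
  constructor <;> linarith [h.1, h.2]

theorem abs_d₁_sub_lt :
    |d₁ - (-0.0311837125986222774945246489936100437425899128713521725307175)| < 1 / 10 ^ 61 := by
  have h := abs_le.1 abs_tsum_b_sub_le
  rw [abs_lt, d₁]
  norm_num only at *
  constructor <;> linarith [h.1, h.2]

theorem abs_d₂_sub_lt :
    |d₂ - 0.81689937948362892278879205623322983539562628691031631640757| < 1 / 10 ^ 59 := by
  have h := abs_le.1 abs_tsum_weighted_a_sub_le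
  have h0 := abs_tsum_a_sub_le
  have h00 := abs_le.1 (abs_mul_sub_mul_le h0 h0 (by rw [abs_le]; norm_num)
    (by rw [abs_le]; norm_num) (by norm_num))
  rw [abs_lt, d₂, d₀, sq]
  norm_num only at *
  constructor <;> linarith [h.1, h.2, h00.1, h00.2]

theorem abs_d₃_sub_lt :
    |d₃ - (-0.008069306849577412439260970341290668150739539610413792698447)| < 1 / 10 ^ 60 := by
  have h := abs_le.1 abs_tsum_weighted_b_sub_le
  have h01 := abs_le.1 (abs_mul_sub_mul_le abs_tsum_a_sub_le abs_tsum_b_sub_le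
    (by rw [abs_le]; norm_num) (by rw [abs_le]; norm_num) (by norm_num))
  rw [abs_lt, d₃, d₀, d₁, mul_assoc]
  norm_num only at *
  constructor <;> linarith [h.1, h.2, h01.1, h01.2]

/-! ### The limit law and the moments -/

theorem limitProb_eq (k : ℕ) : limitProb k = a k - a (k + 1) := by
  rw [limitProb, a, a, pow_succ]
  field_simp
  ring

theorem correctionProb_eq (k : ℕ) : correctionProb k = b k - b (k + 1) := by
  simp only [correctionProb, b, pow_mul', pow_succ (4 : ℝ) k]
  have hx : (0 : ℝ) < 4 ^ k := by positivity
  generalize (4 : ℝ) ^ k = x at *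
  rw [div_sub_div _ _ (by positivity) (by positivity), div_eq_div_iff (by positivity)
    (by positivity)]
  push_cast
  ring

theorem limitProb_nonneg (k : ℕ) : 0 ≤ limitProb k := by
  unfold limitProb
  positivity

theorem tendsto_a : Tendsto a atTop (𝓝 0) := by
  unfold a
  refine Tendsto.div_atTop tendsto_const_nhds (tendsto_atTop_add_const_right _ _ ?_)
  exact tendsto_pow_atTop_atTop_of_one_lt (by norm_num)

theorem hasSum_limitProb : HasSum limitProb 1 := by
  rw [hasSum_iff_tendsto_nat_of_nonneg limitProb_nonneg]
  have h : ∀ N, ∑ k ∈ Finset.range N, limitProb k = 1 - a N := fun N => by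
    simp only [limitProb_eq, Finset.sum_range_sub', a_zero]
  simp only [h]
  simpa using tendsto_a.const_sub 1

theorem tendsto_inv_size : Tendsto (fun n : ℕ+ => 1 / ((n : ℕ) : ℝ)) atTop (𝓝 0) :=
  tendsto_one_div_atTop_nhds_zero_nat.comp tendsto_PNat_val_atTop_atTop

theorem tendsto_tailProb (k : ℕ) : Tendsto (fun n : ℕ+ => tailProb n k) atTop (𝓝 (a k)) := by
  have h1 : Tendsto (fun n : ℕ+ => a k + b k * (1 / ((n : ℕ) : ℝ))) atTop (𝓝 (a k)) := by
    simpa using (tendsto_inv_size.const_mul (b k)).const_add (a k)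
  have h2 : Tendsto (fun n : ℕ+ => 24 * errorConst * ((1 / 3) ^ k / ((n : ℕ) : ℝ) ^ 2)) atTop
      (𝓝 0) := by
    have := ((tendsto_inv_size.pow 2).const_mul ((1 / 3 : ℝ) ^ k)).const_mul (24 * errorConst)
    simpa [div_eq_mul_inv] using this
  have h3 : Tendsto (fun n : ℕ+ => tailProb n k - (a k + b k * (1 / ((n : ℕ) : ℝ)))) atTop
      (𝓝 0) := by
    refine squeeze_zero_norm' ?_ h2
    filter_upwards [eventually_ge_atTop 2] with n hn
    exact abs_tailProb_sub_le hn k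
  simpa using h3.add h1

theorem tendsto_prob (k : ℕ) :
    Tendsto (fun n : ℕ+ => (P n).real {ω | Y n ω = k}) atTop (𝓝 (limitProb k)) := by
  simp only [prob_eq_sub_tailProb, limitProb_eq]
  exact (tendsto_tailProb k).sub (tendsto_tailProb (k + 1))

/-- For k = 0 the bound is 0, as it may be: both tail probabilities involved are exact for n ≥ 2.
For k ≥ 1 the factor k² is only a weakening. -/
theorem abs_prob_sub_le {n : ℕ+} (hn : 2 ≤ n) (k : ℕ) :
    |(P n).real {ω | Y n ω = k} - (limitProb k + correctionProb k * (1 / ((n : ℕ) : ℝ)))| ≤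
      48 * errorConst * ((k : ℝ) ^ 2 / (3 ^ k * ((n : ℕ) : ℝ) ^ 2)) := by
  rw [prob_eq_sub_tailProb, limitProb_eq, correctionProb_eq]
  rcases Nat.eq_zero_or_pos k with rfl | hk
  · rw [tailProb_zero, zero_add, tailProb_one hn, a_zero, a_one, b_zero, b_one]
    norm_num
  · have h0 := abs_le.1 (abs_tailProb_sub_le hn k)
    have h1 := abs_le.1 (abs_tailProb_sub_le hn (k + 1))
    have hK := errorConst_nonneg
    have hk1 : (1 : ℝ) ≤ (k : ℝ) ^ 2 := one_le_pow₀ (by exact_mod_cast hk)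
    have e1 : 24 * errorConst * ((1 / 3) ^ (k + 1) / ((n : ℕ) : ℝ) ^ 2) ≤
        24 * errorConst * ((1 / 3) ^ k / ((n : ℕ) : ℝ) ^ 2) := by
      gcongr ?_ * (?_ / _)
      exact pow_le_pow_of_le_one (by norm_num) (by norm_num) (Nat.le_succ k)
    have e2 : (1 / 3) ^ k / ((n : ℕ) : ℝ) ^ 2 ≤ (k : ℝ) ^ 2 / (3 ^ k * ((n : ℕ) : ℝ) ^ 2) := by
      rw [one_div_pow, div_div]
      gcongr
    have e3 := mul_le_mul_of_nonneg_left e2 (by positivity : 0 ≤ 48 * errorConst)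
    rw [abs_le]
    constructor <;> linarith [h0.1, h0.2, h1.1, h1.2]

/-- The tail error is uniform with factor 3^(-k), so it can be summed against weights of linear
growth. -/
theorem abs_moment_sub_le {w : ℕ → ℝ} (hw : ∀ k, |w k| ≤ 2 * (k + 1)) :
    ∃ M : ℝ, 0 ≤ M ∧ ∀ n : ℕ+, 2 ≤ n → ∀ E : ℝ, HasSum (fun k : ℕ+ => w k * tailProb n k) E →
      |E - ((∑' k : ℕ+, w k * a k) + (∑' k : ℕ+, w k * b k) * (1 / ((n : ℕ) : ℝ)))| ≤
        M / ((n : ℕ) : ℝ) ^ 2 := by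
  have hs : Summable fun k : ℕ+ => 2 * ((k : ℝ) + 1) * (1 / 3 : ℝ) ^ (k : ℕ) := by
    have h1 : Summable fun k : ℕ => (k : ℝ) ^ 1 * (1 / 3 : ℝ) ^ k :=
      summable_pow_mul_geometric_of_norm_lt_one 1 (by norm_num)
    have h0 : Summable fun k : ℕ => (1 / 3 : ℝ) ^ k :=
      summable_geometric_of_lt_one (by norm_num) (by norm_num)
    have h2 : Summable fun k : ℕ => 2 * ((k : ℝ) + 1) * (1 / 3 : ℝ) ^ k :=
      ((h1.add h0).mul_left 2).congr fun k => by ring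
    exact h2.comp_injective PNat.coe_injective
  have hK := errorConst_nonneg
  refine ⟨24 * errorConst * ∑' k : ℕ+, 2 * ((k : ℝ) + 1) * (1 / 3 : ℝ) ^ (k : ℕ),
    mul_nonneg (by positivity) (tsum_nonneg fun k => by positivity), fun n hn E hE => ?_⟩
  have ha := (summable_of_abs_le fun k => abs_weight_mul_le (hw k) (abs_a_le k)).hasSum
  have hb := (summable_of_abs_le fun k => abs_weight_mul_le (hw k) (abs_b_le k)).hasSum
  have h := hE.sub (ha.add (hb.mul_right (1 / ((n : ℕ) : ℝ))))
  have hg := hs.hasSum.mul_left (24 * errorConst / ((n : ℕ) : ℝ) ^ 2)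
  rw [← h.tsum_eq, ← Real.norm_eq_abs]
  refine (tsum_of_norm_bounded hg fun k => ?_).trans (le_of_eq (by ring))
  have e : w k * tailProb n k - (w k * a k + w k * b k * (1 / ((n : ℕ) : ℝ))) =
      w k * (tailProb n k - (a k + b k * (1 / ((n : ℕ) : ℝ)))) := by ring
  rw [e, Real.norm_eq_abs, abs_mul]
  calc |w k| * |tailProb n k - (a k + b k * (1 / ((n : ℕ) : ℝ)))|
      ≤ 2 * ((k : ℝ) + 1) * (24 * errorConst * ((1 / 3) ^ (k : ℕ) / ((n : ℕ) : ℝ) ^ 2)) := by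
        gcongr
        · exact hw k
        · exact abs_tailProb_sub_le hn k
    _ = _ := by ring

theorem exists_abs_integral_Y_sub_le :
    ∃ M : ℝ, 0 ≤ M ∧ ∀ n : ℕ+, 2 ≤ n →
      |(∫ ω, (Y n ω : ℝ) ∂(P n)) - (d₀ + d₁ * (1 / ((n : ℕ) : ℝ)))| ≤ M / ((n : ℕ) : ℝ) ^ 2 := by
  obtain ⟨M, hM, h⟩ := abs_moment_sub_le (w := fun _ => 1) abs_one_le
  refine ⟨M, hM, fun n hn => ?_⟩
  simpa only [one_mul, d₀, d₁] using h n hn _ (by simpa using hasSum_integral_Y n)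

theorem exists_abs_variance_Y_sub_le :
    ∃ M : ℝ, ∀ n : ℕ+, 2 ≤ n →
      |variance (fun ω => (Y n ω : ℝ)) (P n) - (d₂ + d₃ * (1 / ((n : ℕ) : ℝ)))| ≤
        M / ((n : ℕ) : ℝ) ^ 2 := by
  obtain ⟨M, hM, h⟩ := exists_abs_integral_Y_sub_le
  obtain ⟨M', hM', h'⟩ := abs_moment_sub_le (w := fun k => 2 * (k : ℝ) - 1) abs_two_mul_sub_one_le
  refine ⟨M' + (d₁ ^ 2 + 2 * (|d₀| + |d₁|) * M + M ^ 2), fun n hn => ?_⟩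
  have h1 := h n hn
  have h2 := h' n hn _ (hasSum_integral_Y_sq n)
  have hn1 : (1 : ℝ) ≤ ((n : ℕ) : ℝ) := by exact_mod_cast n.pos
  rw [variance_Y, d₂, d₃]
  generalize (∑' k : ℕ+, (2 * (k : ℝ) - 1) * a k) = A at *
  generalize (∑' k : ℕ+, (2 * (k : ℝ) - 1) * b k) = B at *
  generalize (∫ ω, (Y n ω : ℝ) ^ 2 ∂(P n)) = E₂ at *
  generalize (∫ ω, (Y n ω : ℝ) ∂(P n)) = E₁ at *
  generalize ((n : ℕ) : ℝ) = x at *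
  have hx : 0 < x := by linarith
  obtain ⟨e, he⟩ : ∃ e, e = E₁ - (d₀ + d₁ * (1 / x)) := ⟨_, rfl⟩
  rw [← he] at h1
  -- Squaring E₁ = d₀ + d₁/x + e leaves d₁²/x² and the terms containing e, all of order x^(-2).
  have hsplit : E₂ - E₁ ^ 2 - (A - d₀ ^ 2 + (B - 2 * d₀ * d₁) * (1 / x)) =
      (E₂ - (A + B * (1 / x))) - (d₁ ^ 2 / x ^ 2 + 2 * (d₀ + d₁ * (1 / x)) * e + e ^ 2) := by
    rw [he]
    field_simp
    ring
  have hinv : |1 / x| ≤ 1 := by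
    rw [abs_of_pos (by positivity), div_le_one hx]
    exact hn1
  have hmid : |2 * (d₀ + d₁ * (1 / x)) * e| ≤ 2 * (|d₀| + |d₁|) * (M / x ^ 2) := by
    rw [abs_mul, abs_mul, abs_two]
    gcongr
    refine (abs_add_le _ _).trans ?_
    rw [abs_mul]
    gcongr
    exact mul_le_of_le_one_right (abs_nonneg _) hinv
  have hsq : |e ^ 2| ≤ M ^ 2 / x ^ 2 := by
    rw [abs_pow]
    have : |e| ≤ M / x := h1.trans (by
      gcongr
      exact le_self_pow₀ hn1 two_ne_zero)
    calc |e| ^ 2 ≤ (M / x) ^ 2 := by gcongr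
      _ = _ := div_pow _ _ _
  rw [hsplit]
  calc |(E₂ - (A + B * (1 / x))) - (d₁ ^ 2 / x ^ 2 + 2 * (d₀ + d₁ * (1 / x)) * e + e ^ 2)|
      ≤ |E₂ - (A + B * (1 / x))| +
          (|d₁ ^ 2 / x ^ 2| + |2 * (d₀ + d₁ * (1 / x)) * e| + |e ^ 2|) :=
        (abs_sub _ _).trans (add_le_add le_rfl (abs_add_three _ _ _))
    _ ≤ M' / x ^ 2 + (d₁ ^ 2 / x ^ 2 + 2 * (|d₀| + |d₁|) * (M / x ^ 2) + M ^ 2 / x ^ 2) := by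
        rw [abs_of_nonneg (by positivity : 0 ≤ d₁ ^ 2 / x ^ 2)]
        gcongr
    _ = _ := by ring

/-- The estimates proved have order n^(-2), which is stronger than the required n^(-3/2). -/
theorem isBigO_of_abs_le_div_sq {f : ℕ+ → ℝ} {M : ℝ}
    (h : ∀ n : ℕ+, 2 ≤ n → |f n| ≤ M / ((n : ℕ) : ℝ) ^ 2) :
    f =O[atTop] fun n : ℕ+ => 1 / ((n : ℕ) : ℝ) ^ (3 / 2 : ℝ) := by
  have hM : 0 ≤ M := by
    have := (abs_nonneg _).trans (h 2 le_rfl)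
    rwa [le_div_iff₀ (by positivity), zero_mul] at this
  refine IsBigO.of_bound M ?_
  filter_upwards [eventually_ge_atTop 2] with n hn
  have hn1 : (1 : ℝ) ≤ ((n : ℕ) : ℝ) := by exact_mod_cast n.pos
  have hpos : 0 < 1 / ((n : ℕ) : ℝ) ^ (3 / 2 : ℝ) := by positivity
  rw [Real.norm_eq_abs, Real.norm_of_nonneg hpos.le, mul_one_div]
  refine (h n hn).trans ?_
  gcongr
  rw [← Real.rpow_natCast]
  exact Real.rpow_le_rpow_of_exponent_le hn1 (by norm_num)

end PlaneTree

theorem theorem2 :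
    -- the law of `Y n` tends to a discrete limit distribution
    ((∀ k, 0 ≤ PlaneTree.limitProb k) ∧ HasSum PlaneTree.limitProb 1 ∧
      ∀ k : ℕ, Tendsto (fun n : ℕ+ => (PlaneTree.P n).real {ω | PlaneTree.Y n ω = k}) atTop
        (𝓝 (PlaneTree.limitProb k))) ∧
    -- the expansion of the probabilities, uniformly in `k`
    (∃ (C : ℝ) (N : ℕ+), ∀ n : ℕ+, N ≤ n → ∀ k : ℕ,
      |(PlaneTree.P n).real {ω | PlaneTree.Y n ω = k}
          - (PlaneTree.limitProb k + PlaneTree.correctionProb k * (1 / ((n : ℕ) : ℝ)))|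
        ≤ C * ((k : ℝ) ^ 2 / (3 ^ k * ((n : ℕ) : ℝ) ^ 2))) ∧
    -- the series that define the constants converge, and the values of the constants
    (Summable (fun k : ℕ+ => PlaneTree.a k) ∧ Summable (fun k : ℕ+ => PlaneTree.b k) ∧
      Summable (fun k : ℕ+ => (2 * (k : ℝ) - 1) * PlaneTree.a k) ∧
      Summable (fun k : ℕ+ => (2 * (k : ℝ) - 1) * PlaneTree.b k)) ∧
    (|PlaneTree.d₀ - 0.727649276913726097531184400482145348863515722775042276537008|
        < 1 / 10 ^ 60 ∧
      |PlaneTree.d₁ - (-0.0311837125986222774945246489936100437425899128713521725307175)|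
        < 1 / 10 ^ 61 ∧
      |PlaneTree.d₂ - 0.81689937948362892278879205623322983539562628691031631640757|
        < 1 / 10 ^ 59 ∧
      |PlaneTree.d₃ - (-0.008069306849577412439260970341290668150739539610413792698447)|
        < 1 / 10 ^ 60) ∧
    -- the expectation and the variance
    ((fun n : ℕ+ => (∫ ω, (PlaneTree.Y n ω : ℝ) ∂(PlaneTree.P n))
          - (PlaneTree.d₀ + PlaneTree.d₁ * (1 / ((n : ℕ) : ℝ))))
        =O[atTop] fun n : ℕ+ => 1 / ((n : ℕ) : ℝ) ^ (3 / 2 : ℝ)) ∧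
    ((fun n : ℕ+ => variance (fun ω => (PlaneTree.Y n ω : ℝ)) (PlaneTree.P n)
          - (PlaneTree.d₂ + PlaneTree.d₃ * (1 / ((n : ℕ) : ℝ))))
        =O[atTop] fun n : ℕ+ => 1 / ((n : ℕ) : ℝ) ^ (3 / 2 : ℝ)) := by
  open PlaneTree in
  refine ⟨⟨limitProb_nonneg, hasSum_limitProb, tendsto_prob⟩,
    ⟨48 * errorConst, 2, fun n hn k => abs_prob_sub_le hn k⟩, ⟨?_, ?_, ?_, ?_⟩,
    ⟨abs_d₀_sub_lt, abs_d₁_sub_lt, abs_d₂_sub_lt, abs_d₃_sub_lt⟩, ?_, ?_⟩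
  · exact summable_of_abs_le fun k => by
      simpa using abs_weight_mul_le (abs_one_le k) (abs_a_le k)
  · exact summable_of_abs_le fun k => by
      simpa using abs_weight_mul_le (abs_one_le k) (abs_b_le k)
  · exact summable_of_abs_le fun k => abs_weight_mul_le (abs_two_mul_sub_one_le k) (abs_a_le k)
  · exact summable_of_abs_le fun k => abs_weight_mul_le (abs_two_mul_sub_one_le k) (abs_b_le k)
  · obtain ⟨M, -, h⟩ := exists_abs_integral_Y_sub_le
    exact isBigO_of_abs_le_div_sq h
  · obtain ⟨M, h⟩ := exists_abs_variance_Y_sub_le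
    exact isBigO_of_abs_le_div_sq h
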